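/- Let $G=(V,E)$ be a finite simple graph that contains none of the following graphs as an induced subgraph: the claw $K_{1,3}$; the diamond (the complete graph $K_4$ with one edge removed); the co-diamond (the complement of the diamond, i.e. four vertices with exactly one edge). Let $$X_G=\sum_{\kappa}\ \prod_{v\in V}x_{\kappa(v)}$$ be the chromatic symmetric function of $G$ in commuting variables $x_1,x_2,x_3,\dots$, where the sum is over all proper colorings $\kappa:V\to\{1,2,3,\dots\}$ (that is, $\kappa(u)\neq\kappa(v)$ whenever $u$ and $v$ are adjacent). Then $X_G$ is $e$-positive: it is a linear combination, with nonnegative coefficients, of the products $e_\lambda=e_{\lambda_1}e_{\lambda_2}\cdots e_{\lambda_\ell}$, $\lambda=(\lambda_1,\dots,\lambda_\ell)$ an integer partition, where $e_k=\sum_{j_1<\cdots<j_k}x_{j_1}\cdots x_{j_k}$. -/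

import Mathlib

/-! Chromatic symmetric functions, as formal power series over `ℚ` in the commuting variables
`x_i`, `i` a positive integer. -/

namespace ChromSymm

/-- The claw `K_{1,3}`. -/
def claw : SimpleGraph (Fin 1 ⊕ Fin 3) := completeBipartiteGraph (Fin 1) (Fin 3)

/-- The diamond: the complete graph on four vertices with one edge removed. -/
def diamond : SimpleGraph (Fin 4) := (⊤ : SimpleGraph (Fin 4)).deleteEdges {s(1, 3)}

/-- The co-diamond: the complement of the diamond. -/
def coDiamond : SimpleGraph (Fin 4) := diamondᶜ

/-- The exponent vector of the monomial `∏ v, x_{κ v}`. -/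
noncomputable def colorWeight {V : Type*} [Fintype V] (κ : V → ℕ+) : ℕ+ →₀ ℕ :=
  ∑ v, Finsupp.single (κ v) 1

/-- Only finitely many colorings of a finite vertex set contribute to a given monomial, so the
count in `chromaticSymmFun` below is a count of a finite set. -/
theorem finite_colorings_of_weight {V : Type*} [Fintype V] (G : SimpleGraph V) (d : ℕ+ →₀ ℕ) :
    {κ : G.Coloring ℕ+ | colorWeight κ = d}.Finite := by
  have hfin : (Set.univ.pi fun _ : V => (d.support : Set ℕ+)).Finite :=
    Set.Finite.pi fun _ => d.support.finite_toSet
  refine Set.Finite.of_finite_image (f := fun κ : G.Coloring ℕ+ => (κ : V → ℕ+))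
    (hfin.subset ?_) (fun a _ b _ h => DFunLike.coe_injective h)
  rintro _ ⟨κ, hκ, rfl⟩ v -
  have h1 : (Finsupp.single (κ v) 1 : ℕ+ →₀ ℕ) ≤ d := by
    rw [← show colorWeight κ = d from hκ]
    exact Finset.single_le_sum (f := fun v => (Finsupp.single (κ v) 1 : ℕ+ →₀ ℕ))
      (fun _ _ => zero_le) (Finset.mem_univ v)
  have h2 := h1 (κ v)
  simp only [Finsupp.single_eq_same] at h2
  simp only [Finset.mem_coe, Finsupp.mem_support_iff]
  omega

/-- The chromatic symmetric function `X_G = ∑_κ ∏_v x_{κ v}`, the formal sum over all proper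
colorings `κ : V → ℤ⁺`: the coefficient of a monomial is the number of proper colorings `κ` with
that monomial. -/
noncomputable def chromaticSymmFun {V : Type*} [Fintype V] (G : SimpleGraph V) :
    MvPowerSeries ℕ+ ℚ :=
  fun d => ({κ : G.Coloring ℕ+ | colorWeight κ = d}.ncard : ℚ)

open Classical in
/-- The elementary symmetric function `e_k = ∑_{j_1 < ⋯ < j_k} x_{j_1} ⋯ x_{j_k}`: the sum of all
squarefree monomials of degree `k`. -/
noncomputable def elemSymm (k : ℕ) : MvPowerSeries ℕ+ ℚ :=
  fun d => if (∀ i, d i ≤ 1) ∧ d.degree = k then 1 else 0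

/-- `e_λ = e_{λ_1} e_{λ_2} ⋯ e_{λ_ℓ}` for an integer partition `λ`. -/
noncomputable def elemSymmPart {n : ℕ} (p : n.Partition) : MvPowerSeries ℕ+ ℚ :=
  (p.parts.map elemSymm).prod

/-- `f` is e-positive: it is a finite linear combination of the `e_λ`, over integer partitions `λ`,
with nonnegative coefficients. -/
def IsEPositive (f : MvPowerSeries ℕ+ ℚ) : Prop :=
  ∃ c : (Σ n : ℕ, n.Partition) →₀ ℚ, (∀ p, 0 ≤ c p) ∧ f = c.sum fun p a => a • elemSymmPart p.2

end ChromSymm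

/-! The proof splits by the size of the largest stable set. A stable set of size four forces `G` to
be edgeless (`stable_univ_of_card_four`), and then X_G = e_1^n.

Suppose there is a stable triple but no stable set of size four. A vertex outside the triple sees
exactly two of its members: seeing none gives a stable set of size four, one a co-diamond, three a
claw. Sort these vertices by the member they miss. A class is stable (no diamond) and has at most
two elements (no claw), and two elements of a class have complementary neighborhoods in every other
class. One bit thus determines the edges between two classes, so `G` has at most nine vertices and
lies in a finite list of coded graphs. As all exponents in X_G are at most 3, it suffices to expand
in the e_a e_b e_c with a + b + c = n. The kernel does this by Gaussian elimination (`codeCheck`,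
`isEPositive_of_ePosCheck`).

If there is no stable triple, then either two cliques cover the vertices or `G` is the pentagon
(`isEPositive_of_no_stable_triple`); the pentagon is again a computation. Let the cliques be A and B
with |B| ≤ |A| = a and n = |A| + |B|. A color class is a vertex or a non-edge between A and B, so
the coefficient of X_G at a monomial with j squares is (n - 2j)! times the number of ordered
j-matchings in the bipartite complement. Rook theory (`exists_hit`) writes that number times (a -
j)! as a nonnegative combination of falling factorials of k, for k ≤ |B|. After multiplication by (n
- 2j)!/(a - j)!, the k-th term becomes a positive multiple of binom(n - 2j, k - j) times linear
factors m - j with m > a. The binomial is the coefficient of e_{n-k} e_k, and by `InCone.sub_mul`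
such linear factors preserve nonnegative combinations of these coefficient functions. -/

namespace ChromSymm

/-! ### Counting proper colorings of a vertex subset by weight -/

/-- No two elements of `S` are related by `r`. -/
def Stable {V : Type*} (r : V → V → Prop) (S : Finset V) : Prop :=
  ∀ x ∈ S, ∀ y ∈ S, ¬ r x y

/-- The exponent vector of the monomial of `κ` restricted to `U`. -/
noncomputable def weightOn {V : Type*} (κ : V → ℕ+) (U : Finset V) : ℕ+ →₀ ℕ :=
  ∑ v ∈ U, Finsupp.single (κ v) 1

/-- Proper colorings of `U` with a given weight, extended by `1` outside of `U`. -/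
def colSet {V : Type*} (r : V → V → Prop) (U : Finset V) (d : ℕ+ →₀ ℕ) : Set (V → ℕ+) :=
  {κ | (∀ v ∉ U, κ v = 1) ∧ (∀ u ∈ U, ∀ v ∈ U, r u v → κ u ≠ κ v) ∧ weightOn κ U = d}

section
variable {V : Type*}

theorem weightOn_apply (κ : V → ℕ+) (U : Finset V) (i : ℕ+) :
    weightOn κ U i = (U.filter fun u => κ u = i).card := by
  classical
  simp only [weightOn, Finsupp.finsetSum_apply, Finsupp.single_apply, Finset.card_filter]

theorem mem_support_of_weightOn {κ : V → ℕ+} {U : Finset V} {v : V} (hv : v ∈ U) :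
    κ v ∈ (weightOn κ U).support := by
  rw [Finsupp.mem_support_iff, weightOn_apply]
  exact Finset.card_ne_zero_of_mem (Finset.mem_filter.2 ⟨hv, rfl⟩)

theorem weightOn_congr {κ κ' : V → ℕ+} {U : Finset V} (h : ∀ v ∈ U, κ v = κ' v) :
    weightOn κ U = weightOn κ' U :=
  Finset.sum_congr rfl fun v hv => by rw [h v hv]

theorem weightOn_union [DecidableEq V] (κ : V → ℕ+) {U W : Finset V} (h : Disjoint U W) :
    weightOn κ (U ∪ W) = weightOn κ U + weightOn κ W :=
  Finset.sum_union h

theorem weightOn_const {κ : V → ℕ+} {U : Finset V} {i : ℕ+} (h : ∀ v ∈ U, κ v = i) :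
    weightOn κ U = Finsupp.single i U.card := by
  rw [weightOn, Finset.sum_congr rfl fun v hv => by rw [h v hv]]
  simp [Finset.sum_const]

theorem degree_weightOn (κ : V → ℕ+) (U : Finset V) : (weightOn κ U).degree = U.card := by
  simp [weightOn, map_sum]

theorem finite_colSet (r : V → V → Prop) (U : Finset V) (d : ℕ+ →₀ ℕ) : (colSet r U d).Finite := by
  classical
  have hfin : (Set.univ.pi fun _ : U => (d.support : Set ℕ+)).Finite :=
    Set.Finite.pi fun _ => d.support.finite_toSet
  refine Set.Finite.of_finite_image (f := fun κ (u : U) => κ u) (hfin.subset ?_) ?_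
  · rintro _ ⟨κ, ⟨-, -, rfl⟩, rfl⟩ v -
    exact mem_support_of_weightOn v.2
  · rintro κ ⟨h1, -, -⟩ κ' ⟨h2, -, -⟩ h
    funext v
    by_cases hv : v ∈ U
    · exact congrFun h ⟨v, hv⟩
    · rw [h1 v hv, h2 v hv]

/-- The number of proper colorings of `U` with weight `d`. -/
noncomputable def colNum (r : V → V → Prop) (U : Finset V) (d : ℕ+ →₀ ℕ) : ℕ :=
  (finite_colSet r U d).toFinset.card

theorem colNum_eq_ncard (r : V → V → Prop) (U : Finset V) (d : ℕ+ →₀ ℕ) :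
    colNum r U d = (colSet r U d).ncard :=
  (Set.ncard_eq_toFinset_card _ _).symm

theorem colNum_empty (r : V → V → Prop) (d : ℕ+ →₀ ℕ) :
    colNum r ∅ d = if d = 0 then 1 else 0 := by
  rw [colNum_eq_ncard]
  split_ifs with h
  · rw [Set.ncard_eq_one]
    refine ⟨fun _ => 1, ?_⟩
    ext κ
    simp [colSet, weightOn, h, funext_iff]
  · convert Set.ncard_empty (V → ℕ+)
    ext κ
    simpa [colSet, weightOn] using fun _ h' => h h'.symm

theorem exists_of_colNum_ne_zero {r : V → V → Prop} {U : Finset V} {d : ℕ+ →₀ ℕ}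
    (h : colNum r U d ≠ 0) : ∃ κ, κ ∈ colSet r U d := by
  obtain ⟨κ, hκ⟩ := Finset.card_pos.1 (Nat.pos_of_ne_zero h)
  exact ⟨κ, by simpa using hκ⟩

theorem colNum_eq_zero_of_degree {r : V → V → Prop} {U : Finset V} {d : ℕ+ →₀ ℕ}
    (h : d.degree ≠ U.card) : colNum r U d = 0 := by
  by_contra hne
  obtain ⟨κ, -, -, hw⟩ := exists_of_colNum_ne_zero hne
  exact h (hw ▸ degree_weightOn κ U)

/-- A color class is a stable set whose size is the exponent of its color. -/
theorem exists_stable_of_colNum_ne_zero {r : V → V → Prop} {U : Finset V} {d : ℕ+ →₀ ℕ}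
    (h : colNum r U d ≠ 0) (i : ℕ+) : ∃ S ⊆ U, Stable r S ∧ S.card = d i := by
  obtain ⟨κ, -, hp, hw⟩ := exists_of_colNum_ne_zero h
  refine ⟨U.filter fun u => κ u = i, Finset.filter_subset _ _, fun x hx y hy hxy => ?_, ?_⟩
  · rw [Finset.mem_filter] at hx hy
    exact hp x hx.1 y hy.1 hxy (hx.2.trans hy.2.symm)
  · rw [← hw, weightOn_apply]

theorem mem_colFinset {r : V → V → Prop} {U : Finset V} {d : ℕ+ →₀ ℕ} {κ : V → ℕ+} :
    κ ∈ (finite_colSet r U d).toFinset ↔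
      (∀ v ∉ U, κ v = 1) ∧ (∀ u ∈ U, ∀ v ∈ U, r u v → κ u ≠ κ v) ∧ weightOn κ U = d := by
  simp [colSet]

open Classical in
/-- Counting proper colorings by the color class of a vertex. -/
theorem colNum_eq_sum (r : V → V → Prop) {U : Finset V} {v : V} (hv : v ∈ U) (d : ℕ+ →₀ ℕ) :
    colNum r U d = ∑ S ∈ (U.erase v).powerset with Stable r (insert v S),
      ∑ i ∈ d.support with d i = S.card + 1, colNum r (U \ insert v S) (d.erase i) := by
  have hsub : ∀ S ∈ (U.erase v).powerset, insert v S ⊆ U := fun S hS =>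
    Finset.insert_subset hv ((Finset.mem_powerset.1 hS).trans (Finset.erase_subset _ _))
  have hcard : ∀ S ∈ (U.erase v).powerset, (insert v S).card = S.card + 1 := fun S hS =>
    Finset.card_insert_of_notMem fun h => by simpa using Finset.mem_powerset.1 hS h
  have key : colNum r U d = (((U.erase v).powerset.filter fun S => Stable r (insert v S)).sigma
      fun S => (d.support.filter fun i => d i = S.card + 1).sigma
        fun i => (finite_colSet r (U \ insert v S) (d.erase i)).toFinset).card := by
    -- A coloring corresponds to the rest of the color class of `v`, the color of `v`, and the
    -- coloring of the remaining vertices, reset to the default 1 on the removed class.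
    refine Finset.card_nbij'
      (fun κ => ⟨(U.erase v).filter fun u => κ u = κ v, κ v,
        fun u => if u ∈ U ∧ κ u ≠ κ v then κ u else 1⟩)
      (fun p u => if u ∈ insert v p.1 then p.2.1 else p.2.2 u) ?_ ?_ ?_ ?_
    · intro κ hκ
      rw [Finset.mem_coe, mem_colFinset] at hκ
      obtain ⟨h1, h2, h3⟩ := hκ
      have hins : insert v ((U.erase v).filter fun u => κ u = κ v) =
          U.filter fun u => κ u = κ v := by
        ext u
        simp only [Finset.mem_insert, Finset.mem_filter, Finset.mem_erase]
        by_cases huv : u = v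
        · simp [huv, hv]
        · simp [huv]
      have hS : ((U.erase v).filter fun u => κ u = κ v) ∈ (U.erase v).powerset :=
        Finset.mem_powerset.2 (Finset.filter_subset _ _)
      have hc := hcard _ hS
      rw [hins] at hc
      have hdv : d (κ v) = ((U.erase v).filter fun u => κ u = κ v).card + 1 := by
        rw [← h3, weightOn_apply, hc]
      simp only [Finset.coe_sigma, Set.mem_sigma_iff, Finset.mem_coe, Finset.mem_filter,
        mem_colFinset, Finsupp.mem_support_iff]
      refine ⟨⟨hS, ?_⟩, ⟨by omega, hdv⟩, ?_, ?_, ?_⟩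
      · rw [hins]
        intro x hx y hy hxy
        rw [Finset.mem_filter] at hx hy
        exact h2 x hx.1 y hy.1 hxy (hx.2.trans hy.2.symm)
      · intro u hu
        rw [hins] at hu
        rw [if_neg]
        rintro ⟨hu1, hu2⟩
        exact hu (by simp [hu1, hu2])
      · intro x hx y hy hxy
        rw [hins] at hx hy
        simp only [Finset.mem_sdiff, Finset.mem_filter, not_and] at hx hy
        rw [if_pos ⟨hx.1, hx.2 hx.1⟩, if_pos ⟨hy.1, hy.2 hy.1⟩]
        exact h2 x hx.1 y hy.1 hxy
      · rw [hins]
        have e1 : weightOn (fun u => if u ∈ U ∧ κ u ≠ κ v then κ u else 1)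
            (U \ U.filter fun u => κ u = κ v) = weightOn κ (U \ U.filter fun u => κ u = κ v) := by
          refine weightOn_congr fun u hu => ?_
          simp only [Finset.mem_sdiff, Finset.mem_filter, not_and] at hu
          rw [if_pos ⟨hu.1, hu.2 hu.1⟩]
        have e2 := weightOn_union κ (Finset.sdiff_disjoint :
          Disjoint (U \ U.filter fun u => κ u = κ v) (U.filter fun u => κ u = κ v))
        rw [Finset.sdiff_union_of_subset (Finset.filter_subset _ _), h3,
          weightOn_const (U := U.filter fun u => κ u = κ v) (i := κ v)
            (fun u hu => (Finset.mem_filter.1 hu).2)] at e2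
        rw [e1]
        ext i
        by_cases hi : i = κ v
        · subst hi
          rw [Finsupp.erase_same, weightOn_apply, Finset.card_eq_zero]
          ext u
          simp +contextual
        · rw [Finsupp.erase_ne hi, e2]
          simp [Ne.symm hi]
    · rintro ⟨S, i, κ⟩ hp
      simp only [Finset.coe_sigma, Set.mem_sigma_iff, Finset.mem_coe, Finset.mem_filter,
        mem_colFinset, Finsupp.mem_support_iff] at hp
      obtain ⟨⟨hS, hst⟩, ⟨-, hdi⟩, h1, h2, h3⟩ := hp
      -- The color `i` was erased from the weight, so it is unused on the remaining vertices. Hence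
      -- painting the class with `i` keeps the coloring proper.
      have hne : ∀ u ∈ U \ insert v S, κ u ≠ i := by
        rintro u hu rfl
        have := mem_support_of_weightOn (κ := κ) hu
        rw [h3] at this
        simp at this
      rw [Finset.mem_coe, mem_colFinset]
      refine ⟨fun u hu => ?_, fun x hx y hy hxy => ?_, ?_⟩
      · have hu' : u ∉ insert v S := fun h => hu (hsub S hS h)
        simp only [if_neg hu']
        exact h1 u (fun h => hu (Finset.mem_sdiff.1 h).1)
      · by_cases hxS : x ∈ insert v S <;> by_cases hyS : y ∈ insert v S
        · exact absurd hxy (hst x hxS y hyS)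
        · simp only [if_pos hxS, if_neg hyS]
          exact (hne y (Finset.mem_sdiff.2 ⟨hy, hyS⟩)).symm
        · simp only [if_neg hxS, if_pos hyS]
          exact hne x (Finset.mem_sdiff.2 ⟨hx, hxS⟩)
        · simp only [if_neg hxS, if_neg hyS]
          exact h2 x (Finset.mem_sdiff.2 ⟨hx, hxS⟩) y (Finset.mem_sdiff.2 ⟨hy, hyS⟩) hxy
      · rw [← Finset.sdiff_union_of_subset (hsub S hS), weightOn_union _ Finset.sdiff_disjoint,
          weightOn_const (U := insert v S) (i := i) (fun u hu => if_pos hu), hcard S hS,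
          weightOn_congr (κ' := κ) (fun u hu => if_neg (Finset.mem_sdiff.1 hu).2), h3, ← hdi,
          Finsupp.erase_add_single]
    · intro κ hκ
      rw [Finset.mem_coe, mem_colFinset] at hκ
      funext u
      simp only [Finset.mem_insert, Finset.mem_filter, Finset.mem_erase]
      by_cases huv : u = v
      · simp [huv]
      · by_cases huU : u ∈ U
        · by_cases hk : κ u = κ v <;> simp [huv, huU, hk]
        · simp [huv, huU, hκ.1 u huU]
    · rintro ⟨S, i, κ⟩ hp
      simp only [Finset.coe_sigma, Set.mem_sigma_iff, Finset.mem_coe, Finset.mem_filter,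
        mem_colFinset, Finsupp.mem_support_iff] at hp
      obtain ⟨⟨hS, hst⟩, ⟨-, hdi⟩, h1, h2, h3⟩ := hp
      have hne : ∀ u ∈ U, u ∉ insert v S → κ u ≠ i := by
        rintro u hu hu' rfl
        have := mem_support_of_weightOn (κ := κ) (Finset.mem_sdiff.2 ⟨hu, hu'⟩)
        rw [h3] at this
        simp at this
      have hvi : (if v ∈ insert v S then i else κ v) = i := if_pos (Finset.mem_insert_self _ _)
      simp only [hvi]
      congr 1
      · ext u
        simp only [Finset.mem_filter, Finset.mem_erase]
        constructor
        · rintro ⟨⟨huv, hu⟩, h⟩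
          by_contra huS
          have : u ∉ insert v S := by simp [huv, huS]
          rw [if_neg this] at h
          exact hne u hu this h
        · intro hu
          exact ⟨Finset.mem_erase.1 (Finset.mem_powerset.1 hS hu),
            if_pos (Finset.mem_insert_of_mem hu)⟩
      · congr 1
        funext u
        by_cases huS : u ∈ insert v S
        · rw [if_neg (fun h => h.2 (if_pos huS)), h1 u (fun h => (Finset.mem_sdiff.1 h).2 huS)]
        · rw [if_neg huS]
          by_cases huU : u ∈ U
          · rw [if_pos ⟨huU, hne u huU huS⟩]
          · rw [if_neg (fun h => huU h.1), h1 u (fun h => huU (Finset.mem_sdiff.1 h).1)]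
  rw [key, Finset.card_sigma]
  refine Finset.sum_congr rfl fun S _ => ?_
  rw [Finset.card_sigma]
  rfl

end

/-! ### Exponent types and a computable coloring count -/

/-- The number of colors of exponent `m`. -/
def expCount (d : ℕ+ →₀ ℕ) (m : ℕ) : ℕ := (d.support.filter fun i => d i = m).card

theorem expCount_erase {d : ℕ+ →₀ ℕ} {i : ℕ+} (hi : i ∈ d.support) (m : ℕ) :
    expCount (d.erase i) m + (if d i = m then 1 else 0) = expCount d m := by
  classical
  have h1 : ((d.erase i).support.filter fun x => d.erase i x = m) =
      (d.support.filter fun x => d x = m).erase i := by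
    ext x
    by_cases hx : x = i
    · simp [hx]
    · simp [hx, Finsupp.erase_ne]
  rw [expCount, h1]
  split_ifs with h
  · exact Finset.card_erase_add_one (Finset.mem_filter.2 ⟨hi, h⟩)
  · rw [Finset.erase_eq_of_notMem (by simp [h])]
    rfl

theorem expCount_erase_of_mem {d : ℕ+ →₀ ℕ} {i : ℕ+} {m : ℕ} (hi : i ∈ d.support) (h : d i = m)
    (n : ℕ) : expCount (d.erase i) n = expCount d n - if n = m then 1 else 0 := by
  rw [← expCount_erase hi n, h]
  simp only [eq_comm (a := m)]
  omega

theorem degree_erase_add (d : ℕ+ →₀ ℕ) (i : ℕ+) : (d.erase i).degree + d i = d.degree := by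
  conv_rhs => rw [← Finsupp.erase_add_single i d]
  rw [map_add, Finsupp.degree_single]

theorem erase_le (d : ℕ+ →₀ ℕ) (i x : ℕ+) : d.erase i x ≤ d x := by
  rw [Finsupp.erase_apply]
  split_ifs <;> simp

/-- If what remains after removing a color class can be counted from the class alone, the choice of
its color contributes only a factor. -/
theorem colNum_eq_sum_mul [DecidableEq V] (r : V → V → Prop) [DecidablePred (Stable r)]
    {U : Finset V} {v : V} (hv : v ∈ U)
    (d : ℕ+ →₀ ℕ) (F : Finset V → ℕ)
    (hF : ∀ S ⊆ U.erase v, Stable r (insert v S) → ∀ i, i ∈ d.support → d i = S.card + 1 →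
      colNum r (U \ insert v S) (d.erase i) = F S) :
    colNum r U d = ∑ S ∈ (U.erase v).powerset with Stable r (insert v S),
      expCount d (S.card + 1) * F S := by
  rw [colNum_eq_sum r hv]
  refine Finset.sum_congr (by congr!) fun S hS => ?_
  rw [Finset.mem_filter, Finset.mem_powerset] at hS
  rw [expCount, ← smul_eq_mul, ← Finset.sum_const]
  refine Finset.sum_congr rfl fun i hi => ?_
  rw [Finset.mem_filter] at hi
  rw [← hF S hS.1 hS.2 i hi.1 hi.2]
  congr!

/-- The sublists of `l` without two related elements. -/
def stableSubs {α : Type*} (adj : α → α → Bool) : List α → List (List α)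
  | [] => [[]]
  | v :: t => stableSubs adj t ++
      ((stableSubs adj t).filter fun s => s.all fun w => !adj v w).map (List.cons v)

/-- The number of proper colorings of the vertices in the list `l`, where `τ` lists for
`m = 1, 2, …` how many colors are to be used `m` times. -/
def listCount (adj : ℕ → ℕ → Bool) : ℕ → List ℕ → List ℕ → ℕ
  | _, [], τ => if τ.all (· == 0) then 1 else 0
  | 0, _ :: _, _ => 0
  | f + 1, v :: t, τ =>
    ((stableSubs adj (t.filter fun w => !adj v w)).map fun s =>
      -- With `v` the class has `s.length + 1` elements, and that exponent is recorded at index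
      -- `s.length`. The factor `m + 1` chooses the color, which is then used up.
      match τ.getD s.length 0 with
      | 0 => 0
      | m + 1 => (m + 1) * listCount adj f (t.filter fun w => !s.contains w) (τ.set s.length m)).sum

theorem sublist_of_mem_stableSubs {α : Type*} (adj : α → α → Bool) {l s : List α}
    (h : s ∈ stableSubs adj l) : s.Sublist l := by
  induction l generalizing s with
  | nil => simpa [stableSubs] using h
  | cons v t ih =>
    simp only [stableSubs, List.mem_append, List.mem_map, List.mem_filter] at h
    rcases h with h | ⟨s', ⟨h, -⟩, rfl⟩
    · exact (ih h).trans (List.sublist_cons_self _ _)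
    · exact (ih h).cons_cons v

theorem stable_insert_iff {α : Type*} [DecidableEq α] {adj : α → α → Bool}
    (hs : ∀ x y, adj x y = adj y x) (hi : ∀ x, adj x x = false) (v : α) (S : Finset α) :
    Stable (fun x y => adj x y = true) (insert v S) ↔
      Stable (fun x y => adj x y = true) S ∧ ∀ w ∈ S, adj v w = false := by
  simp only [Stable, Finset.mem_insert, forall_eq_or_imp, hi, Bool.not_eq_true]
  constructor
  · rintro ⟨⟨-, h1⟩, h2⟩
    exact ⟨fun x hx => (h2 x hx).2, h1⟩
  · rintro ⟨h1, h2⟩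
    exact ⟨⟨trivial, h2⟩, fun x hx => ⟨by rw [hs]; exact h2 x hx, h1 x hx⟩⟩

-- Each stable subset is listed exactly once: the two halves of the recursion are the subsets
-- without and with the head.
open Classical in
theorem sum_stableSubs {α : Type*} [DecidableEq α] {adj : α → α → Bool}
    (hs : ∀ x y, adj x y = adj y x) (hi : ∀ x, adj x x = false) {l : List α} (hl : l.Nodup)
    (g : Finset α → ℕ) :
    ((stableSubs adj l).map fun s => g s.toFinset).sum =
      ∑ S ∈ l.toFinset.powerset with Stable (fun x y => adj x y = true) S, g S := by
  induction l generalizing g with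
  | nil =>
    rw [Finset.sum_filter]
    simp [stableSubs, Stable]
  | cons v t ih =>
    rw [List.nodup_cons] at hl
    have hv : v ∉ t.toFinset := by simpa using hl.1
    rw [List.toFinset_cons, Finset.sum_filter, Finset.sum_powerset_insert hv, ← Finset.sum_filter,
      ← ih hl.2, stableSubs, List.map_append, List.sum_append]
    congr 1
    have h2 := ih hl.2 (fun S => if ∀ w ∈ S, adj v w = false then g (insert v S) else 0)
    rw [Finset.sum_filter] at h2
    rw [List.map_map]
    have h3 : ∀ L : List (List α), ((L.filter fun s => s.all fun w => !adj v w).map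
        ((fun s => g s.toFinset) ∘ List.cons v)).sum =
        (L.map fun s => if ∀ w ∈ s.toFinset, adj v w = false then
          g (insert v s.toFinset) else 0).sum := by
      intro L
      induction L with
      | nil => rfl
      | cons s L ihL =>
        rw [List.map_cons, List.sum_cons, ← ihL, List.filter_cons]
        by_cases h : ∀ w ∈ s, adj v w = false
        · have : (s.all fun w => !adj v w) = true := by simpa using h
          rw [if_pos this, if_pos (by simpa using h)]
          simp
        · have : ¬ (s.all fun w => !adj v w) = true := by simpa using h
          rw [if_neg this, if_neg (by simpa using h), zero_add]
    rw [h3, h2]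
    refine Finset.sum_congr rfl fun S _ => ?_
    rw [← ite_and]
    exact if_congr (stable_insert_iff hs hi v S).symm rfl rfl

theorem all_eq_zero_iff {τ : List ℕ} {d : ℕ+ →₀ ℕ} (hd : ∀ x, d x ≤ τ.length)
    (hτ : ∀ m < τ.length, τ.getD m 0 = expCount d (m + 1)) :
    (τ.all (· == 0)) = true ↔ d = 0 := by
  rw [List.all_eq_true]
  constructor
  · intro h
    ext x
    by_contra hx
    change d x ≠ 0 at hx
    have h1 := hd x
    have h2 := hτ (d x - 1) (by omega)
    rw [List.getD_eq_getElem _ _ (by omega), Nat.sub_add_cancel (by omega),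
      beq_iff_eq.1 (h _ (List.getElem_mem _))] at h2
    have h3 : x ∈ d.support.filter fun i => d i = d x :=
      Finset.mem_filter.2 ⟨Finsupp.mem_support_iff.2 hx, rfl⟩
    exact Finset.card_ne_zero_of_mem h3 h2.symm
  · rintro rfl y hy
    obtain ⟨m, hm, rfl⟩ := List.mem_iff_getElem.1 hy
    have := hτ m hm
    rw [List.getD_eq_getElem _ _ hm] at this
    simp [this, expCount]

/-- This transfers kernel computations to true coloring counts. The fuel `f` suffices because each
step removes at least the head of the list. -/
theorem colNum_eq_listCount {adj : ℕ → ℕ → Bool} (hs : ∀ x y, adj x y = adj y x)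
    (hi : ∀ x, adj x x = false) (f : ℕ) {l : List ℕ} (hl : l.Nodup) (hf : l.length ≤ f)
    {τ : List ℕ} {d : ℕ+ →₀ ℕ} (hd : ∀ x, d x ≤ τ.length)
    (hτ : ∀ m < τ.length, τ.getD m 0 = expCount d (m + 1)) :
    colNum (fun x y => adj x y = true) l.toFinset d = listCount adj f l τ := by
  classical
  induction f generalizing l τ d with
  | zero =>
    obtain rfl : l = [] := List.eq_nil_of_length_eq_zero (by omega)
    rw [List.toFinset_nil, colNum_empty, listCount]
    exact if_congr (all_eq_zero_iff hd hτ).symm rfl rfl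
  | succ f ih =>
    match l, hl, hf with
    | [], _, _ =>
      rw [List.toFinset_nil, colNum_empty, listCount]
      exact if_congr (all_eq_zero_iff hd hτ).symm rfl rfl
    | v :: t, hl, hf =>
      rw [List.nodup_cons] at hl
      have hvt : v ∉ t.toFinset := by simpa using hl.1
      have hlt : t.length ≤ f := by simpa using hf
      rw [colNum_eq_sum_mul (v := v) _ (by simp) d (fun S => listCount adj f
        (t.filter fun w => w ∉ S) (τ.set S.card (τ.getD S.card 0 - 1)))]
      · have hU : (v :: t).toFinset.erase v = t.toFinset := by
          rw [List.toFinset_cons, Finset.erase_insert hvt]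
        have hfil : (t.toFinset.powerset.filter fun S =>
            Stable (fun x y => adj x y = true) (insert v S)) =
            (t.filter fun w => !adj v w).toFinset.powerset.filter fun S =>
            Stable (fun x y => adj x y = true) S := by
          ext S
          simp only [Finset.mem_filter, Finset.mem_powerset, stable_insert_iff hs hi,
            Finset.subset_iff, List.mem_toFinset, List.mem_filter, Bool.not_eq_true']
          constructor
          · rintro ⟨h1, h2, h3⟩
            exact ⟨fun x hx => ⟨h1 hx, h3 x hx⟩, h2⟩
          · rintro ⟨h1, h2⟩
            exact ⟨fun x hx => (h1 hx).1, h2, fun x hx => (h1 hx).2⟩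
        rw [hU, hfil]
        refine (Finset.sum_congr (by congr!) fun _ _ => rfl).trans
          ((sum_stableSubs hs hi (hl.2.filter _) _).symm.trans ?_)
        rw [listCount]
        congr 1
        refine List.map_congr_left fun s hs' => ?_
        have hsub := sublist_of_mem_stableSubs adj hs'
        have hcard : s.toFinset.card = s.length :=
          List.toFinset_card_of_nodup ((hl.2.filter _).sublist hsub)
        have hfil2 : (t.filter fun w => w ∉ s.toFinset) = t.filter fun w => !s.contains w := by
          refine List.filter_congr fun w _ => ?_
          simp
        rw [hcard, hfil2]
        by_cases hlen : s.length < τ.length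
        · rw [← hτ _ hlen]
          cases τ.getD s.length 0 with
          | zero => simp
          | succ m => simp
        -- Beyond the end of `τ` no color has so large an exponent, in agreement with the default
        -- value 0 of `getD`.
        · have h0 : expCount d (s.length + 1) = 0 := by
            rw [expCount, Finset.card_eq_zero, Finset.filter_eq_empty_iff]
            intro x _
            have := hd x
            omega
          have h1 : τ.getD s.length 0 = 0 := by
            rw [List.getD_eq_default]
            omega
          rw [h0, h1, zero_mul]
      · intro S hS hst i hi' hdi
        have hlen : S.card < τ.length := by
          have := hd i
          omega
        have h1 : (v :: t).toFinset \ insert v S = (t.filter fun w => w ∉ S).toFinset := by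
          ext w
          by_cases hw : w = v
          · subst hw
            simpa using fun h => absurd h hl.1
          · simp [hw]
        rw [h1]
        refine ih (hl.2.filter _) ((List.length_filter_le _ _).trans hlt) (fun x => ?_)
          (fun m hm => ?_)
        · rw [List.length_set]
          exact (erase_le d i x).trans (hd x)
        · rw [List.length_set] at hm
          have h2 := expCount_erase_of_mem hi' hdi (m + 1)
          rw [h2, ← hτ m hm]
          rw [List.getD_eq_getElem _ _ (by simpa using hm), List.getElem_set]
          by_cases hm' : S.card = m
          · subst hm'
            simp
          · rw [if_neg hm', if_neg (by omega), List.getD_eq_getElem _ _ hm]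
            rfl

/-! ### Coefficients of products of three elementary symmetric functions -/

/-- The part of `f` not involving the variable `x_i`. -/
noncomputable def freeOf (i : ℕ+) (f : MvPowerSeries ℕ+ ℚ) : MvPowerSeries ℕ+ ℚ :=
  fun d => if d i = 0 then f d else 0

theorem coeff_freeOf (i : ℕ+) (f : MvPowerSeries ℕ+ ℚ) (d : ℕ+ →₀ ℕ) :
    MvPowerSeries.coeff d (freeOf i f) = if d i = 0 then MvPowerSeries.coeff d f else 0 := rfl

theorem freeOf_mul (i : ℕ+) (f g : MvPowerSeries ℕ+ ℚ) :
    freeOf i (f * g) = freeOf i f * freeOf i g := by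
  classical
  ext d
  rw [coeff_freeOf, MvPowerSeries.coeff_mul, MvPowerSeries.coeff_mul]
  split_ifs with h
  · refine Finset.sum_congr rfl fun p hp => ?_
    have := DFunLike.congr_fun (Finset.HasAntidiagonal.mem_antidiagonal.1 hp) i
    rw [Finsupp.add_apply] at this
    rw [coeff_freeOf, coeff_freeOf, if_pos (by omega), if_pos (by omega)]
  · refine (Finset.sum_eq_zero fun p hp => ?_).symm
    have := DFunLike.congr_fun (Finset.HasAntidiagonal.mem_antidiagonal.1 hp) i
    rw [Finsupp.add_apply] at this
    rw [coeff_freeOf, coeff_freeOf]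
    by_cases h1 : p.1 i = 0
    · rw [if_neg (c := p.2 i = 0) (by omega), mul_zero]
    · rw [if_neg h1, zero_mul]

theorem freeOf_add (i : ℕ+) (f g : MvPowerSeries ℕ+ ℚ) :
    freeOf i (f + g) = freeOf i f + freeOf i g := by
  ext d
  rw [map_add]
  simp only [coeff_freeOf, map_add]
  split_ifs <;> simp

theorem coeff_X_pow_mul_freeOf (i : ℕ+) (m : ℕ) (f : MvPowerSeries ℕ+ ℚ) (d : ℕ+ →₀ ℕ) :
    MvPowerSeries.coeff d (MvPowerSeries.X i ^ m * freeOf i f) =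
      if d i = m then MvPowerSeries.coeff (d.erase i) f else 0 := by
  classical
  rw [MvPowerSeries.X_pow_eq, MvPowerSeries.coeff_monomial_mul, coeff_freeOf, one_mul]
  have h0 : (Finsupp.single i m ≤ d) ↔ m ≤ d i := by simp
  have h1 : (d - Finsupp.single i m) i = d i - m := by simp
  rw [h1, ← ite_and]
  by_cases h : d i = m
  · rw [if_pos ⟨h0.2 h.ge, by omega⟩, if_pos h]
    have h2 : d - Finsupp.single i m = d.erase i := by
      ext x
      by_cases hx : x = i
      · subst hx
        simp [h]
      · simp [Finsupp.erase_ne hx, Ne.symm hx]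
    rw [h2]
  · rw [if_neg h, if_neg]
    rw [h0]
    omega

theorem coeff_elemSymm (a : ℕ) (d : ℕ+ →₀ ℕ) [Decidable ((∀ i, d i ≤ 1) ∧ d.degree = a)] :
    MvPowerSeries.coeff d (elemSymm a) = if (∀ i, d i ≤ 1) ∧ d.degree = a then 1 else 0 := by
  rw [MvPowerSeries.coeff_apply, elemSymm]
  congr!

theorem elemSymm_zero : elemSymm 0 = 1 := by
  classical
  ext d
  rw [coeff_elemSymm, MvPowerSeries.coeff_one]
  refine if_congr ⟨fun h => (Finsupp.degree_eq_zero_iff d).1 h.2, ?_⟩ rfl rfl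
  rintro rfl
  simp

/-- `e_{a-1}`, where `e_{-1} = 0`. -/
noncomputable def elemSymmPred : ℕ → MvPowerSeries ℕ+ ℚ
  | 0 => 0
  | a + 1 => elemSymm a

/-- A squarefree monomial contains a given variable at most once; removing it lowers the degree by
one. -/
theorem elemSymm_eq_add (i : ℕ+) (a : ℕ) :
    elemSymm a = freeOf i (elemSymm a) + MvPowerSeries.X i * freeOf i (elemSymmPred a) := by
  classical
  ext d
  have hX := coeff_X_pow_mul_freeOf i 1 (elemSymmPred a) d
  rw [pow_one] at hX
  rw [map_add, hX, coeff_freeOf]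
  by_cases h0 : d i = 0
  · rw [if_pos h0, if_neg (by omega), add_zero]
  · rw [if_neg h0, zero_add]
    have hdeg := degree_erase_add d i
    split_ifs with h1
    · cases a with
      | zero =>
        rw [coeff_elemSymm, if_neg (by omega)]
        rfl
      | succ a =>
        rw [elemSymmPred, coeff_elemSymm, coeff_elemSymm]
        refine if_congr ?_ rfl rfl
        refine and_congr ⟨fun h x => (erase_le d i x).trans (h x), fun h x => ?_⟩ (by omega)
        by_cases hx : x = i
        · rw [hx, h1]
        · rw [← Finsupp.erase_ne (f := d) hx]
          exact h x
    · rw [coeff_elemSymm, if_neg]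
      rintro ⟨h, -⟩
      have := h i
      omega

/-- The coefficients of `e_a e_b e_c`, sorted by the exponent of one variable. -/
theorem coeff_elemSymm_mul (i : ℕ+) (a b c : ℕ) (d : ℕ+ →₀ ℕ) :
    MvPowerSeries.coeff d (elemSymm a * elemSymm b * elemSymm c) =
      (if d i = 0 then
        MvPowerSeries.coeff (d.erase i) (elemSymm a * elemSymm b * elemSymm c) else 0) +
      (if d i = 1 then
        MvPowerSeries.coeff (d.erase i) (elemSymmPred a * elemSymm b * elemSymm c) +
        MvPowerSeries.coeff (d.erase i) (elemSymm a * elemSymmPred b * elemSymm c) +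
        MvPowerSeries.coeff (d.erase i) (elemSymm a * elemSymm b * elemSymmPred c) else 0) +
      (if d i = 2 then
        MvPowerSeries.coeff (d.erase i) (elemSymmPred a * elemSymmPred b * elemSymm c) +
        MvPowerSeries.coeff (d.erase i) (elemSymmPred a * elemSymm b * elemSymmPred c) +
        MvPowerSeries.coeff (d.erase i) (elemSymm a * elemSymmPred b * elemSymmPred c) else 0) +
      (if d i = 3 then
        MvPowerSeries.coeff (d.erase i) (elemSymmPred a * elemSymmPred b * elemSymmPred c)
        else 0) := by
  have h : elemSymm a * elemSymm b * elemSymm c =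
      MvPowerSeries.X i ^ 0 * freeOf i (elemSymm a * elemSymm b * elemSymm c) +
      MvPowerSeries.X i ^ 1 * freeOf i (elemSymmPred a * elemSymm b * elemSymm c +
        elemSymm a * elemSymmPred b * elemSymm c + elemSymm a * elemSymm b * elemSymmPred c) +
      MvPowerSeries.X i ^ 2 * freeOf i (elemSymmPred a * elemSymmPred b * elemSymm c +
        elemSymmPred a * elemSymm b * elemSymmPred c +
        elemSymm a * elemSymmPred b * elemSymmPred c) +
      MvPowerSeries.X i ^ 3 * freeOf i (elemSymmPred a * elemSymmPred b * elemSymmPred c) := by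
    simp only [freeOf_add, freeOf_mul]
    conv_lhs => rw [elemSymm_eq_add i a, elemSymm_eq_add i b, elemSymm_eq_add i c]
    ring
  conv_lhs => rw [h]
  simp only [map_add, coeff_X_pow_mul_freeOf]

/-- `f (a - 1)`, where `f (-1) = 0`. -/
def predArg (f : ℕ → ℕ) : ℕ → ℕ
  | 0 => 0
  | a + 1 => f a

/-- The coefficient of `e_a e_b e_c` at a monomial with `j` squares and `k` other variables. -/
def eCoeff2 (k : ℕ) : ℕ → ℕ → ℕ → ℕ → ℕ
  | 0, a, b, c => if a + b + c = k then k.factorial / (a.factorial * b.factorial * c.factorial)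
      else 0
  | j + 1, a, b, c => predArg (fun a => predArg (fun b => eCoeff2 k j a b c) b) a +
      predArg (fun a => predArg (fun c => eCoeff2 k j a b c) c) a +
      predArg (fun b => predArg (fun c => eCoeff2 k j a b c) c) b

/-- The coefficient of `e_a e_b e_c` at a monomial with `i` cubes, `j` squares and `k` other
variables. -/
def eCoeff3 (k j : ℕ) : ℕ → ℕ → ℕ → ℕ → ℕ
  | 0, a, b, c => eCoeff2 k j a b c
  | i + 1, a, b, c => predArg (fun a => predArg (fun b => predArg (fun c =>
      eCoeff3 k j i a b c) c) b) a

/-- The coefficient is a multinomial. Cleared of denominators, Pascal's rule becomes (a + b + c) k!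
= (k + 1)! when a + b + c = k + 1, which is the induction step on the number of variables. -/
theorem coeff_elemSymm_mul_of_squarefree {d : ℕ+ →₀ ℕ} (hd : ∀ x, d x ≤ 1) (a b c : ℕ) :
    MvPowerSeries.coeff d (elemSymm a * elemSymm b * elemSymm c) *
      (a.factorial * b.factorial * c.factorial : ℕ) =
      if a + b + c = expCount d 1 then ((expCount d 1).factorial : ℚ) else 0 := by
  classical
  induction hk : expCount d 1 generalizing d a b c with
  | zero =>
    have h0 : d = 0 := by
      ext x
      by_contra hx
      have h1 : d x = 1 := by
        have := hd x
        change d x ≠ 0 at hx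
        omega
      rw [expCount, Finset.card_eq_zero] at hk
      have : x ∈ d.support.filter fun i => d i = 1 :=
        Finset.mem_filter.2 ⟨Finsupp.mem_support_iff.2 hx, h1⟩
      simp [hk] at this
    subst h0
    rw [MvPowerSeries.coeff_zero_eq_constantCoeff, map_mul, map_mul,
      ← MvPowerSeries.coeff_zero_eq_constantCoeff]
    simp only [coeff_elemSymm]
    rcases a with - | a
    · rcases b with - | b
      · rcases c with - | c <;> simp
      · simp
    · simp
  | succ k ih =>
    obtain ⟨i, hi⟩ : (d.support.filter fun i => d i = 1).Nonempty := by
      rw [← Finset.card_pos]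
      unfold expCount at hk
      omega
    rw [Finset.mem_filter] at hi
    have hd' : ∀ x, d.erase i x ≤ 1 := fun x => (erase_le d i x).trans (hd x)
    have hk' : expCount (d.erase i) 1 = k := by
      rw [expCount_erase_of_mem hi.1 hi.2, hk]
      simp
    have key : ∀ p q s, MvPowerSeries.coeff (d.erase i) (elemSymm p * elemSymm q * elemSymm s) *
        (p.factorial * q.factorial * s.factorial : ℕ) =
        if p + q + s = k then (k.factorial : ℚ) else 0 := fun p q s => ih hd' p q s hk'
    rw [coeff_elemSymm_mul i, if_neg (by omega), if_pos hi.2, if_neg (by omega), if_neg (by omega)]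
    have ha : MvPowerSeries.coeff (d.erase i) (elemSymmPred a * elemSymm b * elemSymm c) *
        (a.factorial * b.factorial * c.factorial : ℕ) =
        a * if a + b + c = k + 1 then (k.factorial : ℚ) else 0 := by
      cases a with
      | zero => simp [elemSymmPred]
      | succ a =>
        have := key a b c
        rw [elemSymmPred, if_congr (by omega : a + 1 + b + c = k + 1 ↔ a + b + c = k) rfl rfl,
          ← this, Nat.factorial_succ]
        push_cast
        ring
    have hb : MvPowerSeries.coeff (d.erase i) (elemSymm a * elemSymmPred b * elemSymm c) *
        (a.factorial * b.factorial * c.factorial : ℕ) =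
        b * if a + b + c = k + 1 then (k.factorial : ℚ) else 0 := by
      cases b with
      | zero => simp [elemSymmPred]
      | succ b =>
        have := key a b c
        rw [elemSymmPred, if_congr (by omega : a + (b + 1) + c = k + 1 ↔ a + b + c = k) rfl rfl,
          ← this, Nat.factorial_succ]
        push_cast
        ring
    have hc : MvPowerSeries.coeff (d.erase i) (elemSymm a * elemSymm b * elemSymmPred c) *
        (a.factorial * b.factorial * c.factorial : ℕ) =
        c * if a + b + c = k + 1 then (k.factorial : ℚ) else 0 := by
      cases c with
      | zero => simp [elemSymmPred]
      | succ c =>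
        have := key a b c
        rw [elemSymmPred, if_congr (by omega : a + b + (c + 1) = k + 1 ↔ a + b + c = k) rfl rfl,
          ← this, Nat.factorial_succ]
        push_cast
        ring
    rw [zero_add, add_zero, add_zero, add_mul, add_mul, ha, hb, hc]
    split_ifs with h
    · rw [Nat.factorial_succ, ← h]
      push_cast
      ring
    · ring

/-- A squared variable comes from exactly two of the three factors, which gives the three terms of
the recursion. -/
theorem coeff_elemSymm_mul_eq_eCoeff2 {d : ℕ+ →₀ ℕ} (hd : ∀ x, d x ≤ 2) (a b c : ℕ) :
    MvPowerSeries.coeff d (elemSymm a * elemSymm b * elemSymm c) =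
      eCoeff2 (expCount d 1) (expCount d 2) a b c := by
  induction hj : expCount d 2 generalizing d a b c with
  | zero =>
    have hd1 : ∀ x, d x ≤ 1 := by
      intro x
      by_contra hx
      rw [expCount, Finset.card_eq_zero] at hj
      have h2 := hd x
      have : x ∈ d.support.filter fun i => d i = 2 :=
        Finset.mem_filter.2 ⟨Finsupp.mem_support_iff.2 (by omega), by omega⟩
      simp [hj] at this
    have h := coeff_elemSymm_mul_of_squarefree hd1 a b c
    have hpos : ((a.factorial * b.factorial * c.factorial : ℕ) : ℚ) ≠ 0 := by positivity
    rw [eCoeff2]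
    rw [← eq_div_iff hpos] at h
    rw [h]
    split_ifs with h1
    -- The division in ℕ is exact: a! b! divides (a + b)!, and (a + b)! c! divides (a + b + c)!.
    · rw [Nat.cast_div _ hpos]
      rw [← h1]
      exact (Nat.mul_dvd_mul_right (Nat.factorial_mul_factorial_dvd_factorial_add a b) _).trans
        (Nat.factorial_mul_factorial_dvd_factorial_add (a + b) c)
    · simp
  | succ j ih =>
    obtain ⟨i, hi⟩ : (d.support.filter fun i => d i = 2).Nonempty := by
      rw [← Finset.card_pos]
      unfold expCount at hj
      omega
    rw [Finset.mem_filter] at hi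
    have hd' : ∀ x, d.erase i x ≤ 2 := fun x => (erase_le d i x).trans (hd x)
    have hj' : expCount (d.erase i) 2 = j := by
      rw [expCount_erase_of_mem hi.1 hi.2, hj]
      simp
    have hk' : expCount (d.erase i) 1 = expCount d 1 := by
      rw [expCount_erase_of_mem hi.1 hi.2]
      simp
    have key : ∀ p q s, MvPowerSeries.coeff (d.erase i) (elemSymm p * elemSymm q * elemSymm s) =
        eCoeff2 (expCount d 1) j p q s := fun p q s => by rw [ih hd' p q s hj', hk']
    rw [coeff_elemSymm_mul i, if_neg (by omega), if_neg (by omega), if_pos hi.2,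
      if_neg (by omega), eCoeff2, zero_add, add_zero, zero_add]
    push_cast
    congr 1
    · congr 1
      · cases a <;> cases b <;> simp [elemSymmPred, predArg, key]
      · cases a <;> cases c <;> simp [elemSymmPred, predArg, key]
    · cases b <;> cases c <;> simp [elemSymmPred, predArg, key]

theorem coeff_elemSymm_mul_eq_eCoeff3 {d : ℕ+ →₀ ℕ} (hd : ∀ x, d x ≤ 3) (a b c : ℕ) :
    MvPowerSeries.coeff d (elemSymm a * elemSymm b * elemSymm c) =
      eCoeff3 (expCount d 1) (expCount d 2) (expCount d 3) a b c := by
  induction hj : expCount d 3 generalizing d a b c with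
  | zero =>
    refine coeff_elemSymm_mul_eq_eCoeff2 (fun x => ?_) a b c
    by_contra hx
    rw [expCount, Finset.card_eq_zero] at hj
    have h2 := hd x
    have : x ∈ d.support.filter fun i => d i = 3 :=
      Finset.mem_filter.2 ⟨Finsupp.mem_support_iff.2 (by omega), by omega⟩
    simp [hj] at this
  | succ j ih =>
    obtain ⟨i, hi⟩ : (d.support.filter fun i => d i = 3).Nonempty := by
      rw [← Finset.card_pos]
      unfold expCount at hj
      omega
    rw [Finset.mem_filter] at hi
    have hd' : ∀ x, d.erase i x ≤ 3 := fun x => (erase_le d i x).trans (hd x)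
    have h3 : expCount (d.erase i) 3 = j := by
      rw [expCount_erase_of_mem hi.1 hi.2, hj]
      simp
    have h2 : expCount (d.erase i) 2 = expCount d 2 := by
      rw [expCount_erase_of_mem hi.1 hi.2]
      simp
    have h1 : expCount (d.erase i) 1 = expCount d 1 := by
      rw [expCount_erase_of_mem hi.1 hi.2]
      simp
    have key : ∀ p q s, MvPowerSeries.coeff (d.erase i) (elemSymm p * elemSymm q * elemSymm s) =
        eCoeff3 (expCount d 1) (expCount d 2) j p q s := fun p q s => by
      rw [ih hd' p q s h3, h2, h1]
    rw [coeff_elemSymm_mul i, if_neg (by omega), if_neg (by omega), if_neg (by omega),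
      if_pos hi.2, eCoeff3, zero_add, add_zero, zero_add]
    cases a <;> cases b <;> cases c <;> simp [elemSymmPred, predArg, key]

theorem coeff_elemSymm_mul_eq_zero {d : ℕ+ →₀ ℕ} {x : ℕ+} (hx : 3 < d x) (a b c : ℕ) :
    MvPowerSeries.coeff d (elemSymm a * elemSymm b * elemSymm c) = 0 := by
  rw [coeff_elemSymm_mul x, if_neg (by omega), if_neg (by omega), if_neg (by omega),
    if_neg (by omega)]
  simp

/-! ### Closure properties of e-positivity -/

theorem IsEPositive.zero : IsEPositive 0 := ⟨0, fun _ => le_rfl, by simp⟩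

theorem IsEPositive.add {f g : MvPowerSeries ℕ+ ℚ} (hf : IsEPositive f) (hg : IsEPositive g) :
    IsEPositive (f + g) := by
  classical
  obtain ⟨c, hc, rfl⟩ := hf
  obtain ⟨c', hc', rfl⟩ := hg
  refine ⟨c + c', fun p => add_nonneg (hc p) (hc' p), ?_⟩
  rw [Finsupp.sum_add_index'] <;> simp [add_smul]

theorem IsEPositive.smul {f : MvPowerSeries ℕ+ ℚ} (hf : IsEPositive f) {q : ℚ} (hq : 0 ≤ q) :
    IsEPositive (q • f) := by
  obtain ⟨c, hc, rfl⟩ := hf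
  refine ⟨q • c, fun p => mul_nonneg hq (hc p), ?_⟩
  rw [Finsupp.sum_smul_index' (by simp), Finsupp.smul_sum]
  simp [mul_smul]

theorem IsEPositive.sum {ι : Type*} (s : Finset ι) (f : ι → MvPowerSeries ℕ+ ℚ)
    (h : ∀ i ∈ s, IsEPositive (f i)) : IsEPositive (∑ i ∈ s, f i) :=
  Finset.sum_induction f IsEPositive (fun _ _ => IsEPositive.add) IsEPositive.zero h

/-- `Nat.Partition.ofSums` drops zero parts, which is harmless as e_0 = 1. -/
theorem isEPositive_prod (m : Multiset ℕ) : IsEPositive (m.map elemSymm).prod := by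
  classical
  refine ⟨Finsupp.single ⟨m.sum, Nat.Partition.ofSums m.sum m rfl⟩ 1, fun p => ?_, ?_⟩
  · rw [Finsupp.single_apply]
    split_ifs <;> simp
  · rw [Finsupp.sum_single_index (by simp), one_smul, elemSymmPart]
    change _ = ((m.filter (· ≠ 0)).map elemSymm).prod
    induction m using Multiset.induction_on with
    | empty => simp
    | cons a m ih =>
      rw [Multiset.map_cons, Multiset.prod_cons, ih]
      by_cases ha : a = 0
      · subst ha
        simp [elemSymm_zero]
      · rw [Multiset.filter_cons_of_pos (p := (· ≠ 0)) _ ha, Multiset.map_cons, Multiset.prod_cons]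

theorem isEPositive_elemSymm_mul (a b c : ℕ) :
    IsEPositive (elemSymm a * elemSymm b * elemSymm c) := by
  have := isEPositive_prod {a, b, c}
  simpa [mul_assoc] using this

theorem isEPositive_elemSymm_one_pow (n : ℕ) : IsEPositive (elemSymm 1 ^ n) := by
  have := isEPositive_prod (Multiset.replicate n 1)
  simpa using this

/-! ### Coefficients of X_G as coloring counts; edgeless graphs -/

theorem chromaticSymmFun_apply {V : Type*} [Fintype V] (G : SimpleGraph V) (d : ℕ+ →₀ ℕ) :
    chromaticSymmFun G d = colNum G.Adj Finset.univ d := by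
  rw [chromaticSymmFun, colNum_eq_ncard, ← Set.ncard_image_of_injective
    {κ : G.Coloring ℕ+ | colorWeight κ = d} (f := fun κ : G.Coloring ℕ+ => (κ : V → ℕ+))
    (fun a b h => DFunLike.coe_injective h)]
  congr 2
  ext κ
  constructor
  · rintro ⟨κ, hκ, rfl⟩
    exact ⟨fun v hv => absurd (Finset.mem_univ v) hv, fun u _ v _ h => κ.valid h, hκ⟩
  · rintro ⟨-, h, hw⟩
    exact ⟨SimpleGraph.Coloring.mk κ fun {u v} huv =>
      h u (Finset.mem_univ u) v (Finset.mem_univ v) huv, hw, rfl⟩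

/-- The number of colorings is invariant under relation embeddings. -/
theorem colNum_image {V W : Type*} [DecidableEq W] {r : V → V → Prop} {s : W → W → Prop} {f : V → W}
    (hf : Function.Injective f) (hrs : ∀ u v, r u v ↔ s (f u) (f v)) (U : Finset V)
    (d : ℕ+ →₀ ℕ) : colNum s (U.image f) d = colNum r U d := by
  have hw : ∀ κ : W → ℕ+, weightOn κ (U.image f) = weightOn (κ ∘ f) U := fun κ =>
    Finset.sum_image hf.injOn
  rw [colNum_eq_ncard, colNum_eq_ncard]
  refine Set.ncard_congr (fun κ _ => κ ∘ f) ?_ ?_ ?_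
  · rintro κ ⟨h1, h2, h3⟩
    refine ⟨fun v hv => h1 _ ?_, fun u hu v hv huv => ?_, by rw [← hw, h3]⟩
    · simpa [hf.eq_iff] using hv
    · exact h2 _ (Finset.mem_image_of_mem f hu) _ (Finset.mem_image_of_mem f hv) ((hrs u v).1 huv)
  · rintro κ κ' ⟨h1, -, -⟩ ⟨h1', -, -⟩ h
    funext w
    by_cases hw : w ∈ U.image f
    · obtain ⟨u, -, rfl⟩ := Finset.mem_image.1 hw
      exact congrFun h u
    · rw [h1 w hw, h1' w hw]
  · rintro κ ⟨h1, h2, h3⟩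
    have hext : Function.extend f κ 1 ∘ f = κ := funext fun u => hf.extend_apply κ 1 u
    refine ⟨Function.extend f κ 1, ⟨fun w hw => ?_, ?_, by rw [hw, hext, h3]⟩, hext⟩
    · by_cases h : ∃ u, f u = w
      · obtain ⟨u, rfl⟩ := h
        rw [hf.extend_apply]
        exact h1 u fun hu => hw (Finset.mem_image_of_mem f hu)
      · rw [Function.extend_apply' _ _ _ h]
        rfl
    · intro x hx y hy hxy
      obtain ⟨u, hu, rfl⟩ := Finset.mem_image.1 hx
      obtain ⟨v, hv, rfl⟩ := Finset.mem_image.1 hy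
      rw [hf.extend_apply, hf.extend_apply]
      exact h2 u hu v hv ((hrs u v).2 hxy)

theorem exists_eq_single_of_degree_eq_one {d : ℕ+ →₀ ℕ} (h : d.degree = 1) :
    ∃ i, d = Finsupp.single i 1 := by
  have hd : d ≠ 0 := by
    rintro rfl
    simp at h
  obtain ⟨i, hi⟩ := Finsupp.support_nonempty_iff.2 hd
  have h1 := degree_erase_add d i
  have h2 := Finsupp.mem_support_iff.1 hi
  have h3 : d.erase i = 0 := (Finsupp.degree_eq_zero_iff _).1 (by omega)
  have h4 : d i = 1 := by omega
  exact ⟨i, by rw [← Finsupp.erase_add_single i d, h3, h4, zero_add]⟩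

/-- An edgeless graph on `n` vertices has chromatic symmetric function `e_1 ^ n`. -/
theorem coeff_elemSymm_one_pow {V : Type*} {r : V → V → Prop} (U : Finset V) (hU : Stable r U)
    (d : ℕ+ →₀ ℕ) : MvPowerSeries.coeff d (elemSymm 1 ^ U.card) = colNum r U d := by
  classical
  induction U using Finset.induction_on generalizing d with
  | empty =>
    rw [Finset.card_empty, pow_zero, colNum_empty, MvPowerSeries.coeff_one]
    split_ifs <;> simp
  | insert v U hv ih =>
    have ih' := ih fun x hx y hy =>
      hU x (Finset.mem_insert_of_mem hx) y (Finset.mem_insert_of_mem hy)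
    -- Colorings are grouped by their weight on `U` and the variable given to `v`. Over a pair whose
    -- second entry is a single variable the color of `v` is forced, and no other pair occurs; this
    -- is the convolution with e_1.
    rw [Finset.card_insert_of_notMem hv, pow_succ, MvPowerSeries.coeff_mul, colNum,
      Finset.card_eq_sum_card_fiberwise (t := Finset.HasAntidiagonal.antidiagonal d)
        (f := fun κ : V → ℕ+ => (weightOn κ U, Finsupp.single (κ v) 1)), Nat.cast_sum]
    · refine Finset.sum_congr rfl fun p hp => ?_
      rw [ih', coeff_elemSymm]
      split_ifs with h
      · obtain ⟨i, hi⟩ := exists_eq_single_of_degree_eq_one h.2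
        rw [mul_one, Nat.cast_inj, colNum]
        refine Finset.card_nbij' (fun κ => Function.update κ v i)
          (fun κ => Function.update κ v 1) ?_ ?_ ?_ ?_
        · intro κ hκ
          rw [Finset.mem_coe, mem_colFinset] at hκ
          have hw : weightOn (Function.update κ v i) U = p.1 := by
            rw [← hκ.2.2]
            exact weightOn_congr fun u hu => Function.update_of_ne (by rintro rfl; exact hv hu) _ _
          rw [Finset.mem_coe, Finset.mem_filter, mem_colFinset]
          beta_reduce
          refine ⟨⟨fun u hu => ?_, fun x hx y hy hxy => absurd hxy (hU x hx y hy), ?_⟩, ?_⟩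
          · rw [Finset.mem_insert, not_or] at hu
            rw [Function.update_of_ne hu.1]
            exact hκ.1 u hu.2
          · rw [weightOn, Finset.sum_insert hv, Function.update_self, ← hi,
              ← Finset.HasAntidiagonal.mem_antidiagonal.1 hp, ← hw, add_comm]
            rfl
          · rw [hw, Function.update_self, ← hi]
        · intro κ hκ
          rw [Finset.mem_coe, Finset.mem_filter, mem_colFinset] at hκ
          obtain ⟨⟨h1, -, -⟩, h2⟩ := hκ
          rw [Finset.mem_coe, mem_colFinset]
          beta_reduce
          refine ⟨fun u hu => ?_, fun x hx y hy hxy =>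
            absurd hxy (hU x (Finset.mem_insert_of_mem hx) y (Finset.mem_insert_of_mem hy)), ?_⟩
          · by_cases huv : u = v
            · rw [huv, Function.update_self]
            · rw [Function.update_of_ne huv]
              exact h1 u (by simp [huv, hu])
          · rw [← h2]
            exact weightOn_congr fun u hu => Function.update_of_ne (by rintro rfl; exact hv hu) _ _
        · intro κ hκ
          rw [Finset.mem_coe, mem_colFinset] at hκ
          simp only [Function.update_idem]
          rw [← hκ.1 v hv, Function.update_eq_self]
        · intro κ hκ
          rw [Finset.mem_coe, Finset.mem_filter, mem_colFinset] at hκ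
          have h2 : Finsupp.single (κ v) 1 = Finsupp.single i 1 := by
            rw [← hi, ← hκ.2]
          simp only [Function.update_idem]
          rw [← Finsupp.single_left_injective one_ne_zero h2, Function.update_eq_self]
      · rw [mul_zero, eq_comm, Nat.cast_eq_zero, Finset.card_eq_zero, Finset.filter_eq_empty_iff]
        rintro κ - rfl
        refine h ⟨fun i => ?_, by simp⟩
        simp only [Finsupp.single_apply]
        split_ifs <;> simp
    · intro κ hκ
      rw [Finset.mem_coe, mem_colFinset] at hκ
      rw [Finset.mem_coe, Finset.HasAntidiagonal.mem_antidiagonal, ← hκ.2.2]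
      change weightOn κ U + _ = ∑ u ∈ insert v U, _
      rw [Finset.sum_insert hv, add_comm]
      rfl

theorem isEPositive_of_stable {V : Type*} [Fintype V] (G : SimpleGraph V)
    (h : Stable G.Adj Finset.univ) : IsEPositive (chromaticSymmFun G) := by
  have : chromaticSymmFun G = elemSymm 1 ^ (Finset.univ : Finset V).card := by
    ext d
    rw [coeff_elemSymm_one_pow _ h]
    exact chromaticSymmFun_apply G d
  rw [this]
  exact isEPositive_elemSymm_one_pow _

/-! ### Rook theory: matching numbers and hit numbers -/

open Classical in
/-- The number of ordered matchings with `j` edges between `B` and `A` in the relation `R`. -/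
noncomputable def matchNum {V : Type*} (R : V → V → Prop) : List V → Finset V → ℕ → ℕ
  | [], _, j => if j = 0 then 1 else 0
  | _ :: B, A, 0 => matchNum R B A 0
  | b :: B, A, j + 1 => matchNum R B A (j + 1) +
      (j + 1) * ∑ u ∈ A with R u b, matchNum R B (A.erase u) j

theorem matchNum_eq_zero {V : Type*} (R : V → V → Prop) {B : List V} (A : Finset V) {j : ℕ}
    (h : B.length < j) : matchNum R B A j = 0 := by
  induction B generalizing A j with
  | nil => rw [matchNum, if_neg (by simp at h; omega)]
  | cons b B ih =>
    rw [List.length_cons] at h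
    obtain ⟨j, rfl⟩ : ∃ i, j = i + 1 := ⟨j - 1, by omega⟩
    rw [matchNum, ih A (by omega), Finset.sum_eq_zero fun u _ => ih _ (by omega)]
    rfl

open Classical in
/-- A matching with `j` edges misses all but `j` vertices of `A`. -/
theorem sum_matchNum_erase {V : Type*} (R : V → V → Prop) (B : List V) (A : Finset V) (j : ℕ) :
    ∑ u ∈ A, matchNum R B (A.erase u) j + j * matchNum R B A j = A.card * matchNum R B A j := by
  induction B generalizing A j with
  | nil =>
    simp only [matchNum]
    split_ifs with h <;> simp [h]
  | cons b B ih =>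
    cases j with
    | zero =>
      simp only [matchNum]
      exact ih A 0
    | succ j =>
      simp only [matchNum, Finset.sum_add_distrib, ← Finset.mul_sum]
      have h1 : ∑ u ∈ A, ∑ w ∈ A.erase u with R w b, matchNum R B ((A.erase u).erase w) j =
          ∑ w ∈ A with R w b, ∑ u ∈ A.erase w, matchNum R B ((A.erase w).erase u) j := by
        rw [Finset.sum_comm' (t' := A.filter fun w => R w b) (s' := fun w => A.erase w)]
        · refine Finset.sum_congr rfl fun w _ => Finset.sum_congr rfl fun u _ => ?_
          rw [Finset.erase_right_comm]
        · intro u w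
          simp only [Finset.mem_filter, Finset.mem_erase]
          tauto
      have h2 : ∑ w ∈ A with R w b, ∑ u ∈ A.erase w, matchNum R B ((A.erase w).erase u) j +
          (j + 1) * ∑ w ∈ A with R w b, matchNum R B (A.erase w) j =
          A.card * ∑ w ∈ A with R w b, matchNum R B (A.erase w) j := by
        rw [Finset.mul_sum, Finset.mul_sum, ← Finset.sum_add_distrib]
        refine Finset.sum_congr rfl fun w hw => ?_
        have h3 := ih (A.erase w) j
        have h4 := Finset.card_erase_add_one (Finset.mem_filter.1 hw).1
        rw [← h4, add_mul, add_mul, ← h3]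
        ring
      rw [h1, mul_add (A.card), ← ih A (j + 1)]
      calc _ = ∑ u ∈ A, matchNum R B (A.erase u) (j + 1) + (j + 1) * matchNum R B A (j + 1) +
            (j + 1) * (∑ w ∈ A with R w b, ∑ u ∈ A.erase w, matchNum R B ((A.erase w).erase u) j +
              (j + 1) * ∑ w ∈ A with R w b, matchNum R B (A.erase w) j) := by ring
        _ = _ := by rw [h2]; ring

/-- Pascal's rule for falling factorials; it accounts for the pairs (u, b) that raise the number of
hits by one. -/
theorem succ_descFactorial_eq_add (k j : ℕ) :
    (k + 1).descFactorial (j + 1) = k.descFactorial (j + 1) + (j + 1) * k.descFactorial j := by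
  rw [Nat.succ_descFactorial_succ, Nat.descFactorial_succ, ← add_mul]
  by_cases h : j ≤ k
  · congr 1
    omega
  · rw [Nat.descFactorial_of_lt (by omega), mul_zero, mul_zero]

open Classical in
/-- Matching numbers expressed by hit numbers. -/
theorem exists_hit {V : Type*} (R : V → V → Prop) (B : List V) (A : Finset V)
    (h : B.length ≤ A.card) : ∃ g : ℕ → ℕ, ∀ j, matchNum R B A j * (A.card - j).factorial =
      ∑ k ∈ Finset.range (B.length + 1), g k * k.descFactorial j := by
  induction B generalizing A with
  | nil =>
    -- Only k = 0 occurs. In general `g k` is (|A| - |B|)! times the number of injections from B to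
    -- A with exactly k pairs in `R`.
    refine ⟨fun _ => A.card.factorial, fun j => ?_⟩
    cases j <;> simp [matchNum]
  | cons b B ih =>
    rw [List.length_cons] at h
    have hex : ∀ u : V, ∃ g : ℕ → ℕ, u ∈ A → ∀ j,
        matchNum R B (A.erase u) j * (A.card - 1 - j).factorial =
          ∑ k ∈ Finset.range (B.length + 1), g k * k.descFactorial j := by
      intro u
      by_cases hu : u ∈ A
      · have hc := Finset.card_erase_of_mem hu
        obtain ⟨g, hg⟩ := ih (A.erase u) (by omega)
        rw [hc] at hg
        exact ⟨g, fun _ => hg⟩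
      · exact ⟨0, fun hu' => absurd hu' hu⟩
    choose g hg using hex
    -- Sending `b` to `u` keeps the number of hits if the pair is outside `R` and raises it by one
    -- otherwise. The two `if`s cut off the index that falls outside the range in each case.
    refine ⟨fun k => (∑ u ∈ A with ¬ R u b, if k = B.length + 1 then 0 else g u k) +
      ∑ u ∈ A with R u b, if k = 0 then 0 else g u (k - 1), fun j => ?_⟩
    -- A matching with j edges misses |A| - j vertices `u` of A; this is the leading factor of (|A|
    -- - j)!.
    have hA : matchNum R B A j * (A.card - j).factorial =
        ∑ u ∈ A, matchNum R B (A.erase u) j * (A.card - 1 - j).factorial := by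
      have h1 := sum_matchNum_erase R B A j
      rw [← Finset.sum_mul]
      by_cases hj : B.length < j
      · rw [matchNum_eq_zero R A hj,
          Finset.sum_eq_zero fun u _ => matchNum_eq_zero R (A.erase u) hj]
        simp
      · have h2 : A.card - j = A.card - 1 - j + 1 := by omega
        have h3 : (A.card : ℤ) = (A.card - 1 - j : ℕ) + 1 + j := by omega
        rw [h2, Nat.factorial_succ, ← mul_assoc]
        congr 1
        zify at h1 ⊢
        rw [h3] at h1
        linarith
    have hsplit := Finset.sum_filter_add_sum_filter_not A (fun u => R u b)
      (fun u => matchNum R B (A.erase u) j * (A.card - 1 - j).factorial)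
    have hL : matchNum R (b :: B) A j * (A.card - j).factorial =
        ∑ u ∈ A with ¬ R u b, ∑ k ∈ Finset.range (B.length + 1), g u k * k.descFactorial j +
        ∑ u ∈ A with R u b, ∑ k ∈ Finset.range (B.length + 1),
          g u k * (k + 1).descFactorial j := by
      have e1 : ∑ u ∈ A with ¬ R u b, matchNum R B (A.erase u) j * (A.card - 1 - j).factorial =
          ∑ u ∈ A with ¬ R u b, ∑ k ∈ Finset.range (B.length + 1), g u k * k.descFactorial j :=
        Finset.sum_congr rfl fun u hu => hg u (Finset.mem_filter.1 hu).1 j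
      have e2 : ∑ u ∈ A with R u b, matchNum R B (A.erase u) j * (A.card - 1 - j).factorial =
          ∑ u ∈ A with R u b, ∑ k ∈ Finset.range (B.length + 1), g u k * k.descFactorial j :=
        Finset.sum_congr rfl fun u hu => hg u (Finset.mem_filter.1 hu).1 j
      cases j with
      | zero =>
        rw [matchNum, hA, ← hsplit, e1, e2, add_comm]
        simp
      | succ j =>
        rw [matchNum, add_mul, hA, ← hsplit, e1, e2]
        simp only [succ_descFactorial_eq_add, mul_add, Finset.sum_add_distrib]
        have e3 : (j + 1) * ∑ u ∈ A with R u b, matchNum R B (A.erase u) j =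
            ∑ u ∈ A with R u b, (j + 1) * matchNum R B (A.erase u) j := Finset.mul_sum _ _ _
        have e4 : ∑ u ∈ A with R u b, (j + 1) * matchNum R B (A.erase u) j *
              (A.card - (j + 1)).factorial =
            ∑ u ∈ A with R u b, ∑ k ∈ Finset.range (B.length + 1),
              g u k * ((j + 1) * k.descFactorial j) := by
          refine Finset.sum_congr rfl fun u hu => ?_
          rw [mul_assoc, show A.card - (j + 1) = A.card - 1 - j by omega,
            hg u (Finset.mem_filter.1 hu).1 j, Finset.mul_sum]
          exact Finset.sum_congr rfl fun k _ => by ring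
        rw [e3, Finset.sum_mul, e4]
        ring
    rw [hL, List.length_cons]
    simp only [add_mul, Finset.sum_add_distrib, Finset.sum_mul]
    congr 1
    · rw [Finset.sum_comm, Finset.sum_range_succ _ (B.length + 1)]
      simp only [if_true, zero_mul, Finset.sum_const_zero, add_zero]
      refine Finset.sum_congr rfl fun k hk => Finset.sum_congr rfl fun u _ => ?_
      rw [if_neg (by rw [Finset.mem_range] at hk; omega)]
    · rw [Finset.sum_comm, Finset.sum_range_succ' _ (B.length + 1)]
      simp

/-! ### Colorings of a union of two cliques -/

theorem degree_eq_expCount {d : ℕ+ →₀ ℕ} (hd : ∀ x, d x ≤ 2) :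
    d.degree = expCount d 1 + 2 * expCount d 2 := by
  rw [expCount, expCount, Finset.card_filter, Finset.card_filter, Finset.mul_sum,
    ← Finset.sum_add_distrib, Finsupp.degree_apply]
  refine Finset.sum_congr rfl fun x hx => ?_
  have h1 := hd x
  have h2 := Finsupp.mem_support_iff.1 hx
  obtain h | h : d x = 1 ∨ d x = 2 := by omega
  · simp [h]
  · simp [h]

/-- Colorings of a clique. -/
theorem colNum_of_clique {V : Type*} {r : V → V → Prop} (hi : ∀ x, ¬ r x x) (A : Finset V)
    (hA : ∀ u ∈ A, ∀ v ∈ A, u ≠ v → r u v) {d : ℕ+ →₀ ℕ} (hd : ∀ x, d x ≤ 2)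
    (hdeg : d.degree = A.card) :
    colNum r A d = if expCount d 2 = 0 then (expCount d 1).factorial else 0 := by
  classical
  induction A using Finset.induction_on generalizing d with
  | empty =>
    rw [Finset.card_empty, Finsupp.degree_eq_zero_iff] at hdeg
    subst hdeg
    simp [colNum_empty, expCount]
  | insert v A hv ih =>
    have hdeg' := degree_eq_expCount hd
    rw [Finset.card_insert_of_notMem hv] at hdeg
    rw [colNum_eq_sum_mul r (Finset.mem_insert_self v A) d (fun _ =>
      if expCount d 2 = 0 then (expCount d 1 - 1).factorial else 0)]
    · have hS : (((insert v A).erase v).powerset.filter fun S => Stable r (insert v S)) = {∅} := by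
        ext S
        simp only [Finset.mem_filter, Finset.mem_powerset, Finset.mem_singleton,
          Finset.erase_insert hv]
        constructor
        · rintro ⟨h1, h2⟩
          refine Finset.eq_empty_of_forall_notMem fun x hx => ?_
          exact h2 v (Finset.mem_insert_self _ _) x (Finset.mem_insert_of_mem hx)
            (hA v (Finset.mem_insert_self _ _) x (Finset.mem_insert_of_mem (h1 hx))
              (by rintro rfl; exact hv (h1 hx)))
        · rintro rfl
          refine ⟨Finset.empty_subset _, fun x hx y hy => ?_⟩
          simp only [insert_empty_eq, Finset.mem_singleton] at hx hy
          subst hx hy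
          exact hi _
      rw [hS, Finset.sum_singleton, Finset.card_empty, zero_add]
      split_ifs with h
      · obtain ⟨m, hm⟩ : ∃ m, expCount d 1 = m + 1 := ⟨expCount d 1 - 1, by omega⟩
        rw [hm, Nat.factorial_succ, Nat.add_sub_cancel]
      · rw [mul_zero]
    · intro S hS hst i hi' hdi
      have hSe : S = ∅ := by
        refine Finset.eq_empty_of_forall_notMem fun x hx => ?_
        have h1 := hS hx
        rw [Finset.erase_insert hv] at h1
        exact hst v (Finset.mem_insert_self _ _) x (Finset.mem_insert_of_mem hx)
            (hA v (Finset.mem_insert_self _ _) x (Finset.mem_insert_of_mem h1)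
              (by rintro rfl; exact hv h1))
      subst hSe
      rw [Finset.card_empty, zero_add] at hdi
      have hU : insert v A \ insert v ∅ = A := by
        rw [insert_empty_eq, Finset.sdiff_singleton_eq_erase, Finset.erase_insert hv]
      rw [hU, ih (fun u hu w hw => hA u (Finset.mem_insert_of_mem hu) w
        (Finset.mem_insert_of_mem hw)) (fun x => (erase_le d i x).trans (hd x))
        (by have := degree_erase_add d i; omega), expCount_erase_of_mem hi' hdi,
        expCount_erase_of_mem hi' hdi]
      simp

open Classical in
/-- Colorings of a union of two cliques. -/
theorem colNum_of_two_cliques {V : Type*} {r : V → V → Prop} (hs : ∀ x y, r x y → r y x)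
    (hi : ∀ x, ¬ r x x) (B : List V) (A : Finset V) (hnd : B.Nodup) (hAB : ∀ x ∈ B, x ∉ A)
    (hA : ∀ u ∈ A, ∀ v ∈ A, u ≠ v → r u v) (hB : ∀ u ∈ B, ∀ v ∈ B, u ≠ v → r u v)
    (hle : B.length ≤ A.card) {d : ℕ+ →₀ ℕ} (hd : ∀ x, d x ≤ 2)
    (hdeg : d.degree = A.card + B.length) :
    colNum r (A ∪ B.toFinset) d = matchNum (fun u b => ¬ r u b) B A (expCount d 2) *
      (expCount d 1).factorial := by
  induction B generalizing A d with
  | nil =>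
    rw [List.toFinset_nil, Finset.union_empty, colNum_of_clique hi A hA hd (by simpa using hdeg),
      matchNum]
    split_ifs <;> simp
  | cons b B ih =>
    rw [List.length_cons] at hdeg hle
    rw [List.nodup_cons] at hnd
    have hdeg' := degree_eq_expCount hd
    have hbA : b ∉ A := hAB b List.mem_cons_self
    have hUe : (A ∪ (b :: B).toFinset).erase b = A ∪ B.toFinset := by
      ext x
      by_cases hx : x = b
      · subst hx
        simp [hbA, hnd.1]
      · simp [hx]
    have hbU : b ∈ A ∪ (b :: B).toFinset := by simp
    -- A stable set meets each clique at most once, so the color class of `b` is a singleton or a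
    -- non-edge to A.
    have hchar : ∀ S ⊆ (A ∪ (b :: B).toFinset).erase b, (Stable r (insert b S) ↔
        S = ∅ ∨ ∃ u ∈ A, ¬ r u b ∧ S = {u}) := by
      intro S hS
      rw [hUe] at hS
      constructor
      · intro hst
        by_cases hSe : S = ∅
        · exact Or.inl hSe
        · right
          have hSA : ∀ x ∈ S, x ∈ A := by
            intro x hx
            have h1 := hS hx
            rw [Finset.mem_union, List.mem_toFinset] at h1
            refine h1.resolve_right fun hxB => ?_
            refine hst b (Finset.mem_insert_self _ _) x (Finset.mem_insert_of_mem hx)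
              (hB b List.mem_cons_self x (List.mem_cons_of_mem _ hxB) ?_)
            rintro rfl
            exact hnd.1 hxB
          obtain ⟨u, hu⟩ := Finset.nonempty_iff_ne_empty.2 hSe
          refine ⟨u, hSA u hu, hst u (Finset.mem_insert_of_mem hu) b (Finset.mem_insert_self _ _),
            ?_⟩
          refine Finset.eq_singleton_iff_unique_mem.2 ⟨hu, fun w hw => ?_⟩
          by_contra hne
          exact hst w (Finset.mem_insert_of_mem hw) u (Finset.mem_insert_of_mem hu)
            (hA w (hSA w hw) u (hSA u hu) hne)
      · rintro (rfl | ⟨u, hu, hub, rfl⟩)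
        · intro x hx y hy
          simp only [insert_empty_eq, Finset.mem_singleton] at hx hy
          subst hx hy
          exact hi _
        · intro x hx y hy
          simp only [Finset.mem_insert, Finset.mem_singleton] at hx hy
          rcases hx with rfl | rfl <;> rcases hy with rfl | rfl
          · exact hi _
          · exact fun h => hub (hs _ _ h)
          · exact hub
          · exact hi _
    rw [colNum_eq_sum_mul r hbU d (fun S =>
      if S = ∅ then matchNum (fun u b => ¬ r u b) B A (expCount d 2) * (expCount d 1 - 1).factorial
      else matchNum (fun u b => ¬ r u b) B (A \ S) (expCount d 2 - 1) *
        (expCount d 1).factorial)]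
    · have hfil : ((A ∪ (b :: B).toFinset).erase b).powerset.filter
          (fun S => Stable r (insert b S)) =
          insert ∅ ((A.filter fun u => ¬ r u b).image fun u => {u}) := by
        ext S
        rw [Finset.mem_filter, Finset.mem_powerset, Finset.mem_insert, Finset.mem_image]
        constructor
        · rintro ⟨h1, h2⟩
          refine ((hchar S h1).1 h2).imp_right ?_
          rintro ⟨u, hu, hub, rfl⟩
          exact ⟨u, Finset.mem_filter.2 ⟨hu, hub⟩, rfl⟩
        · intro h
          have h1 : S ⊆ (A ∪ (b :: B).toFinset).erase b := by
            rcases h with rfl | ⟨u, hu, rfl⟩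
            · exact Finset.empty_subset _
            · rw [hUe, Finset.singleton_subset_iff]
              exact Finset.mem_union_left _ (Finset.mem_filter.1 hu).1
          refine ⟨h1, (hchar S h1).2 (h.imp_right ?_)⟩
          rintro ⟨u, hu, rfl⟩
          exact ⟨u, (Finset.mem_filter.1 hu).1, (Finset.mem_filter.1 hu).2, rfl⟩
      rw [hfil, Finset.sum_insert (by simp), Finset.sum_image (by simp)]
      simp only [Finset.card_empty, Finset.card_singleton, if_true, Finset.singleton_ne_empty,
        if_false, zero_add, Finset.sdiff_singleton_eq_erase]
      have h1 : expCount d 1 * (matchNum (fun u b => ¬ r u b) B A (expCount d 2) *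
          (expCount d 1 - 1).factorial) =
          matchNum (fun u b => ¬ r u b) B A (expCount d 2) * (expCount d 1).factorial := by
        -- If no variable has exponent one, the number of squares is half of all vertices. It then
        -- exceeds the length of the tail `B`, as A is larger than that tail, and both sides vanish.
        -- This disposes of the truncated 0 - 1.
        by_cases h0 : expCount d 1 = 0
        · rw [matchNum_eq_zero]
          · simp
          · omega
        · obtain ⟨m, hm⟩ : ∃ m, expCount d 1 = m + 1 := ⟨expCount d 1 - 1, by omega⟩
          rw [hm, Nat.factorial_succ, Nat.add_sub_cancel]
          ring
      rw [h1]
      cases expCount d 2 with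
      | zero => simp [matchNum]
      | succ j =>
        rw [matchNum, add_mul, Finset.mul_sum, Finset.sum_mul, Nat.add_sub_cancel]
        congr 1
        refine Finset.sum_congr (by congr!) fun u _ => by ring
    · intro S hS hst i hi' hdi
      have hdeg1 := degree_erase_add d i
      have hd' : ∀ x, d.erase i x ≤ 2 := fun x => (erase_le d i x).trans (hd x)
      rcases (hchar S hS).1 hst with rfl | ⟨u, hu, hub, rfl⟩
      · rw [Finset.card_empty, zero_add] at hdi
        rw [insert_empty_eq, Finset.sdiff_singleton_eq_erase, hUe, if_pos rfl,
          ih A hnd.2 (fun x hx => hAB x (List.mem_cons_of_mem _ hx)) hA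
          (fun u hu v hv => hB u (List.mem_cons_of_mem _ hu) v (List.mem_cons_of_mem _ hv))
          (by omega) hd' (by omega), expCount_erase_of_mem hi' hdi, expCount_erase_of_mem hi' hdi]
        simp
      · rw [Finset.card_singleton] at hdi
        have hU : (A ∪ (b :: B).toFinset) \ insert b {u} = A.erase u ∪ B.toFinset := by
          ext x
          by_cases hxb : x = b
          · subst hxb
            simp [hbA, hnd.1]
          · by_cases hxu : x = u
            · subst hxu
              have : x ∉ B := fun h => hAB x (List.mem_cons_of_mem _ h) hu
              simp [this]
            · simp [hxb, hxu]
        have hc := Finset.card_erase_add_one hu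
        rw [hU, if_neg (Finset.singleton_ne_empty u),
          ih (A.erase u) hnd.2 (fun x hx h => hAB x (List.mem_cons_of_mem _ hx)
            (Finset.mem_of_mem_erase h))
          (fun x hx y hy => hA x (Finset.mem_of_mem_erase hx) y (Finset.mem_of_mem_erase hy))
          (fun u hu v hv => hB u (List.mem_cons_of_mem _ hu) v (List.mem_cons_of_mem _ hv))
          (by omega) hd' (by omega), expCount_erase_of_mem hi' hdi, expCount_erase_of_mem hi' hdi,
          Finset.sdiff_singleton_eq_erase]
        simp

/-! ### The cone spanned by the coefficients of e_{n-i} e_i -/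

theorem eCoeff2_zero_right (k j a b : ℕ) :
    eCoeff2 k j a b 0 = if j ≤ b ∧ j ≤ a ∧ a + b = k + 2 * j then k.choose (b - j) else 0 := by
  induction j generalizing a b with
  | zero =>
    rw [eCoeff2]
    by_cases h : a + b = k
    · subst h
      simp [Nat.add_choose]
    · rw [if_neg (by omega), if_neg (by omega)]
  | succ j ih =>
    rw [eCoeff2]
    cases a with
    | zero => cases b <;> simp [predArg]
    | succ a =>
      cases b with
      | zero => simp [predArg]
      | succ b =>
        simp only [predArg, ih, add_zero, Nat.add_sub_add_right]
        exact if_congr (by omega) rfl rfl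

/-- The coefficient of `e_{n-i} e_i` at a monomial with `j` squares and no higher powers. -/
def twoCoeff (n i j : ℕ) : ℕ := if j ≤ i then (n - 2 * j).choose (i - j) else 0

theorem coeff_elemSymm_mul_two {d : ℕ+ →₀ ℕ} (hd : ∀ x, d x ≤ 2) {n i : ℕ} (hi : 2 * i ≤ n) :
    MvPowerSeries.coeff d (elemSymm (n - i) * elemSymm i * elemSymm 0) =
      if d.degree = n then (twoCoeff n i (expCount d 2) : ℚ) else 0 := by
  have hdeg := degree_eq_expCount hd
  rw [coeff_elemSymm_mul_eq_eCoeff2 hd, eCoeff2_zero_right, twoCoeff]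
  by_cases h : d.degree = n
  · rw [if_pos h]
    by_cases h2 : expCount d 2 ≤ i
    · rw [if_pos (by omega), if_pos h2]
      congr 2
      omega
    · rw [if_neg (by omega), if_neg h2]
  · rw [if_neg h, if_neg (by omega), Nat.cast_zero]

/-- A telescoping sum: since (s + 1) binom(N, s + 1) = (N - s) binom(N, s), consecutive left sides
differ by (N - 2s) binom(N, s). The bound on `s` makes all subtractions exact. -/
theorem mul_choose_eq_sum (N s : ℕ) (hs : 2 * s ≤ N + 1) :
    s * N.choose s = ∑ l ∈ Finset.range s, (N - 2 * l) * N.choose l := by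
  induction s with
  | zero => simp
  | succ s ih =>
    rw [Finset.sum_range_succ, ← ih (by omega), ← add_mul, mul_comm (s + 1),
      Nat.choose_succ_right_eq, mul_comm]
    congr 1
    omega

/-- This is `mul_choose_eq_sum` for N = n - 2j and s = i - j; the terms with l < j vanish. It
expresses the factor i - j through generators of smaller index with nonnegative coefficients. -/
theorem sub_mul_twoCoeff {n i : ℕ} (hi : 2 * i ≤ n) (j : ℕ) :
    (i - j) * twoCoeff n i j = ∑ l ∈ Finset.range i, (n - 2 * l) * twoCoeff n l j := by
  by_cases hj : j ≤ i
  · obtain ⟨s, rfl⟩ := Nat.exists_eq_add_of_le hj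
    rw [Finset.sum_range_add, Finset.sum_eq_zero, zero_add]
    · simp only [twoCoeff, Nat.add_sub_cancel_left, Nat.le_add_right, if_true]
      rw [mul_choose_eq_sum _ _ (by omega)]
      refine Finset.sum_congr rfl fun l _ => ?_
      congr 1
      omega
    · intro l hl
      rw [Finset.mem_range] at hl
      rw [twoCoeff, if_neg (by omega), mul_zero]
  · rw [Finset.sum_eq_zero, Nat.sub_eq_zero_of_le (by omega), zero_mul]
    intro l hl
    rw [Finset.mem_range] at hl
    rw [twoCoeff, if_neg (by omega), mul_zero]

/-- The functions which are combinations of `twoCoeff n i` for `i ≤ K` with nonnegative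
coefficients. -/
def InCone (n K : ℕ) (f : ℕ → ℚ) : Prop :=
  ∃ g : ℕ → ℚ, (∀ i, 0 ≤ g i) ∧ ∀ j, f j = ∑ i ∈ Finset.range (K + 1), g i * twoCoeff n i j

theorem InCone.add {n K : ℕ} {f f' : ℕ → ℚ} (h : InCone n K f) (h' : InCone n K f') :
    InCone n K (fun j => f j + f' j) := by
  obtain ⟨g, hg, hf⟩ := h
  obtain ⟨g', hg', hf'⟩ := h'
  refine ⟨fun i => g i + g' i, fun i => add_nonneg (hg i) (hg' i), fun j => ?_⟩
  simp only [hf, hf', add_mul, Finset.sum_add_distrib]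

theorem InCone.const_mul {n K : ℕ} {f : ℕ → ℚ} (h : InCone n K f) {q : ℚ} (hq : 0 ≤ q) :
    InCone n K (fun j => q * f j) := by
  obtain ⟨g, hg, hf⟩ := h
  refine ⟨fun i => q * g i, fun i => mul_nonneg hq (hg i), fun j => ?_⟩
  simp only [hf, Finset.mul_sum, mul_assoc]

theorem InCone.sum {ι : Type*} {n K : ℕ} (s : Finset ι) (f : ι → ℕ → ℚ)
    (h : ∀ i ∈ s, InCone n K (f i)) : InCone n K (fun j => ∑ i ∈ s, f i j) := by
  classical
  induction s using Finset.induction_on with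
  | empty => exact ⟨0, fun _ => le_rfl, fun j => by simp⟩
  | insert i s hi ih =>
    simp only [Finset.sum_insert hi]
    exact (h i (Finset.mem_insert_self _ _)).add
      (ih fun i hi => h i (Finset.mem_insert_of_mem hi))

theorem inCone_twoCoeff (n : ℕ) {i K : ℕ} (hi : i ≤ K) : InCone n K (fun j => twoCoeff n i j) := by
  refine ⟨fun l => if l = i then 1 else 0, fun l => by dsimp only; split_ifs <;> simp, fun j => ?_⟩
  simp only [ite_mul, one_mul, zero_mul]
  rw [Finset.sum_ite_eq' _ i, if_pos (by simp; omega)]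

theorem InCone.mono {n K K' : ℕ} {f : ℕ → ℚ} (h : InCone n K f) (hK : K ≤ K') :
    InCone n K' f := by
  obtain ⟨g, hg, hf⟩ := h
  have h2 := InCone.sum (n := n) (K := K') (Finset.range (K + 1))
    (fun i j => g i * twoCoeff n i j) fun i hi => (inCone_twoCoeff n (by
      rw [Finset.mem_range] at hi; omega)).const_mul (hg i)
  have : f = fun j => ∑ i ∈ Finset.range (K + 1), g i * twoCoeff n i j := funext hf
  rwa [this]

/-- On the generator of index i write m - j = (m - i) + (i - j) for j ≤ i. The first summand is a
nonnegative constant because i ≤ K ≤ m, and the second is handled by `sub_mul_twoCoeff`. For j > i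
the generator vanishes. -/
theorem InCone.sub_mul {n K : ℕ} (hK : 2 * K ≤ n) {f : ℕ → ℚ} (h : InCone n K f) {m : ℕ}
    (hm : K ≤ m) : InCone n K (fun j => ((m - j : ℕ) : ℚ) * f j) := by
  have key : ∀ i ∈ Finset.range (K + 1),
      InCone n K (fun j => ((m - j : ℕ) : ℚ) * twoCoeff n i j) := by
    intro i hi
    rw [Finset.mem_range] at hi
    have h1 : InCone n K (fun j => ((m - i : ℕ) : ℚ) * twoCoeff n i j +
        ∑ l ∈ Finset.range i, ((n - 2 * l : ℕ) : ℚ) * twoCoeff n l j) :=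
      ((inCone_twoCoeff n (by omega)).const_mul (by positivity)).add
        (InCone.sum _ _ fun l hl => (inCone_twoCoeff n (by
          rw [Finset.mem_range] at hl; omega)).const_mul (by positivity))
    convert h1 using 2 with j
    have h2 := sub_mul_twoCoeff (n := n) (i := i) (by omega) j
    rw [← Nat.cast_mul, ← Nat.cast_mul, Finset.sum_congr rfl fun l _ => (Nat.cast_mul _ _).symm,
      ← Nat.cast_sum, ← h2, ← Nat.cast_add, ← add_mul]
    by_cases hj : j ≤ i
    · congr 2
      omega
    · rw [twoCoeff, if_neg hj, mul_zero, mul_zero]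
  obtain ⟨g, hg, hf⟩ := h
  have h2 := InCone.sum (Finset.range (K + 1)) _ fun i hi => (key i hi).const_mul (hg i)
  convert h2 using 2 with j
  rw [hf, Finset.mul_sum]
  exact Finset.sum_congr rfl fun i _ => by ring

theorem inCone_ascFactorial {n k a : ℕ} (hk : 2 * k ≤ n) (hka : k ≤ a) (m : ℕ) :
    InCone n k (fun j => ((∏ t ∈ Finset.range m, (a + 1 + t - j) : ℕ) : ℚ) * twoCoeff n k j) := by
  induction m with
  | zero => simpa using inCone_twoCoeff n le_rfl
  | succ m ih =>
    have := ih.sub_mul hk (m := a + 1 + m) (by omega)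
    convert this using 2 with j
    rw [Finset.prod_range_succ, Nat.cast_mul]
    ring

theorem factorial_mul_prod {a j : ℕ} (hj : j ≤ a) (m : ℕ) :
    (a - j).factorial * ∏ t ∈ Finset.range m, (a + 1 + t - j) = (a + m - j).factorial := by
  induction m with
  | zero => simp
  | succ m ih =>
    rw [Finset.prod_range_succ, ← mul_assoc, ih, show a + (m + 1) - j = a + m - j + 1 by omega,
      Nat.factorial_succ, mul_comm]
    congr 1
    omega

/-- Expand (a + b - 2j)! as binom(a + b - 2j, k - j) (k - j)! (a + b - k - j)!. The middle factorial
completes the falling factorial to k!, and dividing the last by (a - j)! leaves the product of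
linear factors. -/
theorem descFactorial_mul_factorial {a b k j : ℕ} (hk : k ≤ b) (hb : b ≤ a) (hj : j ≤ a) :
    k.descFactorial j * (a + b - 2 * j).factorial = (a - j).factorial * (k.factorial *
      ((∏ t ∈ Finset.range (b - k), (a + 1 + t - j)) * twoCoeff (a + b) k j)) := by
  by_cases hjk : j ≤ k
  · have h1 := factorial_mul_prod hj (b - k)
    have h2 := Nat.choose_mul_factorial_mul_factorial
      (show k - j ≤ a + b - 2 * j by omega)
    have h3 := Nat.factorial_mul_descFactorial hjk
    rw [show a + b - 2 * j - (k - j) = a + (b - k) - j by omega, ← h1] at h2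
    rw [twoCoeff, if_pos hjk, ← h2, ← h3]
    ring
  · rw [Nat.descFactorial_of_lt (by omega), twoCoeff, if_neg hjk]
    simp

/-- Matching numbers of a bipartite relation lie in the cone. -/
theorem inCone_matchNum {V : Type*} (R : V → V → Prop) (B : List V) (A : Finset V)
    (h : B.length ≤ A.card) : ∃ f, InCone (A.card + B.length) B.length f ∧
      ∀ j, 2 * j ≤ A.card + B.length →
        (matchNum R B A j * (A.card + B.length - 2 * j).factorial : ℕ) = f j := by
  obtain ⟨g, hg⟩ := exists_hit R B A h
  refine ⟨_, InCone.sum (Finset.range (B.length + 1)) (fun k j => ((g k * k.factorial : ℕ) : ℚ) *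
    (((∏ t ∈ Finset.range (B.length - k), (A.card + 1 + t - j) : ℕ) : ℚ) *
      twoCoeff (A.card + B.length) k j)) fun k hk => ?_, fun j hj => ?_⟩
  · rw [Finset.mem_range] at hk
    exact ((inCone_ascFactorial (by omega) (by omega) _).mono (by omega)).const_mul (by positivity)
  · have hpos : (A.card - j).factorial ≠ 0 := Nat.factorial_ne_zero _
    have key : matchNum R B A j * (A.card + B.length - 2 * j).factorial =
        ∑ k ∈ Finset.range (B.length + 1), g k * k.factorial *
          ((∏ t ∈ Finset.range (B.length - k), (A.card + 1 + t - j)) *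
            twoCoeff (A.card + B.length) k j) := by
      refine Nat.eq_of_mul_eq_mul_left (Nat.pos_of_ne_zero hpos) ?_
      rw [← mul_assoc, mul_comm (A.card - j).factorial, hg, Finset.sum_mul, Finset.mul_sum]
      refine Finset.sum_congr rfl fun k hk => ?_
      rw [Finset.mem_range] at hk
      rw [mul_assoc, descFactorial_mul_factorial (by omega) h (by omega)]
      ring
    rw [key]
    push_cast
    rfl

theorem isEPositive_of_two_cliques {V : Type*} [Fintype V] (G : SimpleGraph V) (A : Finset V)
    (hA : ∀ u ∈ A, ∀ v ∈ A, u ≠ v → G.Adj u v) (hB : ∀ u ∉ A, ∀ v ∉ A, u ≠ v → G.Adj u v) :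
    IsEPositive (chromaticSymmFun G) := by
  classical
  -- The hit number expansion needs the smaller clique in the role of the list.
  wlog hle : (Aᶜ).card ≤ A.card generalizing A
  · exact this Aᶜ (fun u hu v hv => hB u (Finset.mem_compl.1 hu) v (Finset.mem_compl.1 hv))
      (fun u hu v hv => hA u (by simpa using hu) v (by simpa using hv))
      (by rw [compl_compl]; omega)
  set B := (Aᶜ).toList with hBdef
  have hlen : B.length = (Aᶜ).card := Finset.length_toList _
  have hmem : ∀ x, x ∈ B ↔ x ∉ A := fun x => by rw [hBdef, Finset.mem_toList, Finset.mem_compl]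
  rw [← hlen] at hle
  have hU : A ∪ B.toFinset = Finset.univ := by
    ext x
    by_cases hx : x ∈ A <;> simp [hx, hmem]
  have hcard : (Finset.univ : Finset V).card = A.card + B.length := by
    rw [hlen, Finset.card_compl, Finset.card_univ]
    have := Finset.card_le_univ A
    omega
  obtain ⟨f, ⟨g, hg0, hg⟩, hf⟩ := inCone_matchNum (fun u b => ¬ G.Adj u b) B A hle
  -- The factor e_0 = 1 makes the coefficient formulas for triple products applicable.
  have hX : chromaticSymmFun G = ∑ i ∈ Finset.range (B.length + 1),
      g i • (elemSymm (A.card + B.length - i) * elemSymm i * elemSymm 0) := by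
    ext d
    rw [map_sum]
    simp only [map_smul, smul_eq_mul]
    rw [MvPowerSeries.coeff_apply, chromaticSymmFun_apply]
    by_cases hd : ∀ x, d x ≤ 2
    · rw [Finset.sum_congr rfl fun i hi => by
        rw [coeff_elemSymm_mul_two hd (by rw [Finset.mem_range] at hi; omega)]]
      by_cases hdeg : d.degree = A.card + B.length
      · simp only [if_pos hdeg]
        have hdeg' := degree_eq_expCount hd
        rw [← hg, ← hf _ (by omega), ← hU, colNum_of_two_cliques (fun _ _ h => h.symm)
          (fun _ => G.irrefl) B A (Finset.nodup_toList _) (fun x hx => (hmem x).1 hx) hA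
          (fun u hu v hv => hB u ((hmem u).1 hu) v ((hmem v).1 hv)) hle hd hdeg]
        congr 3
        omega
      · simp only [if_neg hdeg, mul_zero, Finset.sum_const_zero]
        rw [colNum_eq_zero_of_degree (by rw [hcard]; exact hdeg), Nat.cast_zero]
    · push Not at hd
      obtain ⟨x, hx⟩ := hd
      rw [Finset.sum_eq_zero]
      · by_contra hne
        obtain ⟨S, -, hst, hSc⟩ := exists_stable_of_colNum_ne_zero (fun h => hne (by rw [h]; simp)) x
        have h1 : (S.filter (· ∈ A)).card ≤ 1 := Finset.card_le_one.2 fun u hu v hv => by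
          rw [Finset.mem_filter] at hu hv
          by_contra h
          exact hst u hu.1 v hv.1 (hA u hu.2 v hv.2 h)
        have h2 : (S.filter (· ∉ A)).card ≤ 1 := Finset.card_le_one.2 fun u hu v hv => by
          rw [Finset.mem_filter] at hu hv
          by_contra h
          exact hst u hu.1 v hv.1 (hB u hu.2 v hv.2 h)
        have h3 := Finset.card_filter_add_card_filter_not (s := S) (· ∈ A)
        omega
      · intro i _
        rw [coeff_elemSymm_mul x, if_neg (by omega), if_neg (by omega), if_neg (by omega)]
        simp [elemSymmPred]
  rw [hX]
  exact IsEPositive.sum _ _ fun i _ => (isEPositive_elemSymm_mul _ _ _).smul (hg0 i)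

/-! ### Certificates for e-positivity by Gaussian elimination -/

/-- The partitions `a ≥ b ≥ c ≥ 0` of `n`. -/
def threeParts (n : ℕ) : List (ℕ × ℕ × ℕ) :=
  (List.range (n + 1)).flatMap fun a => (List.range (a + 1)).flatMap fun b =>
    (List.range (b + 1)).filterMap fun c => if a + b + c = n then some (a, b, c) else none

theorem mem_threeParts {n : ℕ} (t : ℕ × ℕ × ℕ) :
    t ∈ threeParts n ↔ t.2.2 ≤ t.2.1 ∧ t.2.1 ≤ t.1 ∧ t.1 + t.2.1 + t.2.2 = n := by
  obtain ⟨a, b, c⟩ := t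
  simp only [threeParts, List.mem_flatMap, List.mem_range, List.mem_filterMap,
    Option.ite_none_right_eq_some, Option.some.injEq, Prod.mk.injEq]
  constructor
  · rintro ⟨a, ha, b, hb, c, hc, h, rfl, rfl, rfl⟩
    omega
  · intro h
    exact ⟨a, by omega, b, by omega, c, by omega, h.2.2, rfl, rfl, rfl⟩

/-- The coloring counts of the vertices in `l`, listed by the conjugate of the exponent type. -/
def countVec (adj : ℕ → ℕ → Bool) (l : List ℕ) : List ℕ :=
  (threeParts l.length).map fun t =>
    listCount adj l.length l [t.1 - t.2.1, t.2.1 - t.2.2, t.2.2]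

/-- The coefficients of `e_a e_b e_c`, listed by the conjugate of the exponent type. -/
def elemVec (n : ℕ) (s : ℕ × ℕ × ℕ) : List ℕ :=
  (threeParts n).map fun t => eCoeff3 (t.1 - t.2.1) (t.2.1 - t.2.2) t.2.2 s.1 s.2.1 s.2.2

/-- Gaussian elimination of `x` by the vectors in a list, with pivots at the positions
`m, m + 1, …`. The answer is `true` if all multipliers are nonnegative and nothing is left. -/
def eliminates : List (List ℕ) → ℕ → List ℕ → Bool
  | [], _, x => x.all (· == 0)
  | row :: rows, m, x =>
    row.getD m 0 != 0 &&
    -- This test makes the truncated subtraction in the next step exact; cross-multiplication with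
    -- the pivots keeps all entries in ℕ.
    (row.zip x).all (fun p => Nat.ble (x.getD m 0 * p.1) (row.getD m 0 * p.2)) &&
    eliminates rows (m + 1) ((row.zip x).map fun p => row.getD m 0 * p.2 - x.getD m 0 * p.1)

/-- A certificate for e-positivity of the graph on `l`. -/
def ePosCheck (adj : ℕ → ℕ → Bool) (l : List ℕ) : Bool :=
  eliminates ((threeParts l.length).map (elemVec l.length)) 0 (countVec adj l)

/-- The conjugate of the partition formed by the exponents of `d`, if these are at most `3`. -/
def conjType (d : ℕ+ →₀ ℕ) : ℕ × ℕ × ℕ :=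
  (expCount d 1 + expCount d 2 + expCount d 3, expCount d 2 + expCount d 3, expCount d 3)

theorem degree_eq_expCount_three {d : ℕ+ →₀ ℕ} (hd : ∀ x, d x ≤ 3) :
    d.degree = expCount d 1 + 2 * expCount d 2 + 3 * expCount d 3 := by
  rw [expCount, expCount, expCount, Finset.card_filter, Finset.card_filter, Finset.card_filter,
    Finset.mul_sum, Finset.mul_sum, ← Finset.sum_add_distrib, ← Finset.sum_add_distrib,
    Finsupp.degree_apply]
  refine Finset.sum_congr rfl fun x hx => ?_
  have h1 := hd x
  have h2 := Finsupp.mem_support_iff.1 hx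
  obtain h | h | h : d x = 1 ∨ d x = 2 ∨ d x = 3 := by omega
  all_goals simp [h]

theorem conjType_mem {d : ℕ+ →₀ ℕ} (hd : ∀ x, d x ≤ 3) {n : ℕ} (hn : d.degree = n) :
    conjType d ∈ threeParts n := by
  rw [mem_threeParts, ← hn, degree_eq_expCount_three hd]
  simp only [conjType]
  omega

open Classical in
/-- The symmetric function of degree `n` with the coefficients listed in `x`. -/
noncomputable def ofVec (n : ℕ) (x : List ℕ) : MvPowerSeries ℕ+ ℚ :=
  fun d => if (∀ i, d i ≤ 3) ∧ d.degree = n then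
    (x.getD ((threeParts n).idxOf (conjType d)) 0 : ℚ) else 0

theorem getD_map_idxOf {α : Type*} [BEq α] [LawfulBEq α] (L : List α) (f : α → ℕ) {a : α} (h : a ∈ L) :
    (L.map f).getD (L.idxOf a) 0 = f a := by
  have h1 := List.idxOf_lt_length_of_mem h
  rw [List.getD_eq_getElem _ _ (by simpa using h1), List.getElem_map, List.getElem_idxOf h1]

theorem eCoeff2_eq_zero {k j a b c : ℕ} (h : a + b + c ≠ k + 2 * j) : eCoeff2 k j a b c = 0 := by
  induction j generalizing a b c with
  | zero => rw [eCoeff2, if_neg (by omega)]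
  | succ j ih =>
    rw [eCoeff2]
    cases a <;> cases b <;> cases c <;> simp only [predArg] <;> simp <;>
      first | exact ih (by omega) | exact ⟨⟨ih (by omega), ih (by omega)⟩, ih (by omega)⟩

theorem eCoeff3_eq_zero {k j i a b c : ℕ} (h : a + b + c ≠ k + 2 * j + 3 * i) :
    eCoeff3 k j i a b c = 0 := by
  induction i generalizing a b c with
  | zero => exact eCoeff2_eq_zero h
  | succ i ih =>
    rw [eCoeff3]
    cases a <;> cases b <;> cases c <;> simp only [predArg]
    exact ih (by omega)

theorem ofVec_elemVec {n : ℕ} (s : ℕ × ℕ × ℕ) (hs : s.1 + s.2.1 + s.2.2 = n) :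
    ofVec n (elemVec n s) = elemSymm s.1 * elemSymm s.2.1 * elemSymm s.2.2 := by
  classical
  ext d
  rw [MvPowerSeries.coeff_apply, ofVec]
  by_cases hd : ∀ x, d x ≤ 3
  · rw [coeff_elemSymm_mul_eq_eCoeff3 hd]
    by_cases hn : d.degree = n
    · rw [if_pos ⟨hd, hn⟩, elemVec, getD_map_idxOf _ _ (conjType_mem hd hn)]
      simp only [conjType]
      congr 2 <;> omega
    · rw [if_neg (fun h => hn h.2), eCoeff3_eq_zero, Nat.cast_zero]
      rw [← degree_eq_expCount_three hd]
      omega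
  · rw [if_neg (fun h => hd h.1)]
    push Not at hd
    obtain ⟨x, hx⟩ := hd
    rw [coeff_elemSymm_mul_eq_zero hx]

/-- Undoing one step gives `x` as 1/p times the sum of the remainder and q times the row, with p > 0
and q ≥ 0. Soundness needs no triangularity. That the pivots suit the `elemVec` rows is due to the
lexicographic order of `threeParts`: e_λ contains only monomials whose conjugate type dominates λ.
-/
theorem isEPositive_of_eliminates {n N : ℕ} {rows : List (List ℕ)} {m : ℕ} {x : List ℕ}
    (hrows : ∀ row ∈ rows, row.length = N ∧ IsEPositive (ofVec n row)) (hx : x.length = N)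
    (h : eliminates rows m x = true) : IsEPositive (ofVec n x) := by
  classical
  induction rows generalizing m x with
  | nil =>
    have h0 : ofVec n x = 0 := by
      ext d
      rw [MvPowerSeries.coeff_apply, ofVec]
      rw [eliminates, List.all_eq_true] at h
      have : ∀ i, x.getD i 0 = 0 := by
        intro i
        by_cases hi : i < x.length
        · rw [List.getD_eq_getElem _ _ hi]
          exact beq_iff_eq.1 (h _ (List.getElem_mem hi))
        · exact List.getD_eq_default _ _ (by omega)
      simp only [this]
      simp
    rw [h0]
    exact IsEPositive.zero
  | cons row rows ih =>
    simp only [eliminates, Bool.and_eq_true, bne_iff_ne, ne_eq, List.all_eq_true] at h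
    obtain ⟨⟨h1, h2⟩, h3⟩ := h
    obtain ⟨hlen, hrow⟩ := hrows row List.mem_cons_self
    have h4 := ih (fun r hr => hrows r (List.mem_cons_of_mem _ hr))
      (by rw [List.length_map, List.length_zip]; omega) h3
    set p := row.getD m 0
    set q := x.getD m 0
    have hp : (p : ℚ) ≠ 0 := by exact_mod_cast h1
    have key : ofVec n x = (p : ℚ)⁻¹ •
        (ofVec n ((row.zip x).map fun y => p * y.2 - q * y.1) + (q : ℚ) • ofVec n row) := by
      ext d
      rw [map_smul, map_add, map_smul, eq_comm, smul_eq_mul, inv_mul_eq_iff_eq_mul₀ hp]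
      simp only [MvPowerSeries.coeff_apply, ofVec, smul_eq_mul]
      split_ifs with hd
      · generalize (threeParts n).idxOf (conjType d) = i
        by_cases hi : i < N
        · have hz : i < (row.zip x).length := by rw [List.length_zip]; omega
          rw [List.getD_eq_getElem _ _ (by simpa using hz), List.getD_eq_getElem _ _ (by omega),
            List.getD_eq_getElem _ _ (by omega), List.getElem_map]
          have h5 := h2 _ (List.getElem_mem hz)
          rw [Nat.ble_eq] at h5
          rw [Nat.cast_sub h5, List.getElem_zip]
          push_cast
          ring
        · rw [List.getD_eq_default _ _ (by rw [List.length_map, List.length_zip]; omega),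
            List.getD_eq_default _ _ (by omega), List.getD_eq_default _ _ (by omega)]
          simp
      · simp
    rw [key]
    exact (h4.add (hrow.smul (by positivity))).smul (by positivity)

/-- Color classes have at most three elements, so X_G involves only exponents up to 3 and is
determined by one coloring count for each conjugate type. -/
theorem isEPositive_of_ePosCheck {V : Type*} [Fintype V] {G : SimpleGraph V}
    {adj : ℕ → ℕ → Bool} (hs : ∀ x y, adj x y = adj y x) (hi : ∀ x, adj x x = false)
    {l : List ℕ} (hl : l.Nodup) {f : V → ℕ} (hf : Function.Injective f)
    (hadj : ∀ u v, G.Adj u v ↔ adj (f u) (f v) = true)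
    (hfl : Finset.univ.image f = l.toFinset)
    (hst : ∀ S : Finset V, Stable G.Adj S → S.card ≤ 3) (h : ePosCheck adj l = true) :
    IsEPositive (chromaticSymmFun G) := by
  classical
  have hcard : (Finset.univ : Finset V).card = l.length := by
    rw [← Finset.card_image_of_injective _ hf, hfl, List.toFinset_card_of_nodup hl]
  have hX : chromaticSymmFun G = ofVec l.length (countVec adj l) := by
    ext d
    rw [MvPowerSeries.coeff_apply, MvPowerSeries.coeff_apply, chromaticSymmFun_apply, ofVec]
    split_ifs with hd
    · obtain ⟨hd, hn⟩ := hd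
      -- The successive differences of the conjugate type, followed by its last part, are the
      -- numbers of variables with exponents 1, 2 and 3.
      rw [countVec, getD_map_idxOf _ _ (conjType_mem hd hn), ← colNum_image (s := fun x y => adj x y = true) hf hadj, hfl,
        colNum_eq_listCount (τ := [(conjType d).1 - (conjType d).2.1,
          (conjType d).2.1 - (conjType d).2.2, (conjType d).2.2]) hs hi l.length hl le_rfl hd]
      intro m hm
      simp only [conjType]
      change m < 3 at hm
      interval_cases m
      · simp
        omega
      · simp
      · simp
    · rw [Nat.cast_eq_zero]
      by_contra hne
      refine hd ⟨fun x => ?_, ?_⟩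
      · obtain ⟨S, -, h1, h2⟩ := exists_stable_of_colNum_ne_zero hne x
        rw [← h2]
        exact hst S h1
      · by_contra hdeg
        exact hne (colNum_eq_zero_of_degree (by rw [hcard]; exact hdeg))
  rw [hX]
  refine isEPositive_of_eliminates (N := (threeParts l.length).length) (fun row hrow => ?_)
    (by rw [countVec, List.length_map]) h
  obtain ⟨s, hs, rfl⟩ := List.mem_map.1 hrow
  refine ⟨by rw [elemVec, List.length_map], ?_⟩
  rw [ofVec_elemVec s ((mem_threeParts s).1 hs).2.2]
  exact isEPositive_elemSymm_mul _ _ _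

/-! ### Forbidden subgraphs and large stable sets -/

section
variable {V : Type*} {G : SimpleGraph V}

theorem isIndContained_of_injective {W : Type*} {H : SimpleGraph W} {f : W → V}
    (hf : Function.Injective f) (h : ∀ a b, G.Adj (f a) (f b) ↔ H.Adj a b) :
    H.IsIndContained G :=
  ⟨⟨⟨f, hf⟩, h _ _⟩⟩

theorem not_claw (h : ¬ claw.IsIndContained G) {c x y z : V} (hx : G.Adj c x) (hy : G.Adj c y)
    (hz : G.Adj c z) (hxy : x ≠ y) (hxz : x ≠ z) (hyz : y ≠ z) (nxy : ¬ G.Adj x y)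
    (nxz : ¬ G.Adj x z) (nyz : ¬ G.Adj y z) : False := by
  refine h (isIndContained_of_injective (f := Sum.elim (fun _ => c) ![x, y, z]) ?_ ?_)
  · rintro (a | a) (b | b) hab
    · rw [Subsingleton.elim a b]
    · fin_cases b
      · exact absurd hab hx.ne
      · exact absurd hab hy.ne
      · exact absurd hab hz.ne
    · fin_cases a
      · exact absurd hab.symm hx.ne
      · exact absurd hab.symm hy.ne
      · exact absurd hab.symm hz.ne
    · fin_cases a <;> fin_cases b <;> simp_all
  · rintro (a | a) (b | b)
    · simp [claw]
    · fin_cases b <;> simp [claw, hx, hy, hz]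
    · fin_cases a <;> simp [claw, hx.symm, hy.symm, hz.symm]
    · fin_cases a <;> fin_cases b <;>
        simp [claw, nxy, nxz, nyz, mt SimpleGraph.Adj.symm nxy, mt SimpleGraph.Adj.symm nxz,
          mt SimpleGraph.Adj.symm nyz]

theorem not_diamond (h : ¬ diamond.IsIndContained G) {x y p q : V} (hxy : G.Adj x y)
    (hxp : G.Adj x p) (hxq : G.Adj x q) (hyp : G.Adj y p) (hyq : G.Adj y q) (hpq : p ≠ q) :
    G.Adj p q := by
  by_contra npq
  refine h (isIndContained_of_injective (f := ![x, p, y, q]) ?_ ?_)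
  · intro a b hab
    have := hxy.ne
    have := hxp.ne
    have := hxq.ne
    have := hyp.ne
    have := hyq.ne
    fin_cases a <;> fin_cases b <;> simp_all
  · intro a b
    fin_cases a <;> fin_cases b <;>
      simp [diamond, hxy, hxp, hxq, hyp, hyq, hxy.symm, hxp.symm, hxq.symm, hyp.symm, hyq.symm,
        npq, mt SimpleGraph.Adj.symm npq]

theorem not_coDiamond (h : ¬ coDiamond.IsIndContained G) {x y p q : V} (hpq : G.Adj p q)
    (hxy : x ≠ y) (hxp : x ≠ p) (hxq : x ≠ q) (hyp : y ≠ p) (hyq : y ≠ q) (nxy : ¬ G.Adj x y)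
    (nxp : ¬ G.Adj x p) (nxq : ¬ G.Adj x q) (nyp : ¬ G.Adj y p) (nyq : ¬ G.Adj y q) : False := by
  refine h (isIndContained_of_injective (f := ![x, p, y, q]) ?_ ?_)
  · intro a b hab
    have := hpq.ne
    fin_cases a <;> fin_cases b <;> simp_all
  · intro a b
    fin_cases a <;> fin_cases b <;>
      simp [coDiamond, diamond, hpq, hpq.symm, nxy, nxp, nxq, nyp, nyq, mt SimpleGraph.Adj.symm nxy,
        mt SimpleGraph.Adj.symm nxp, mt SimpleGraph.Adj.symm nxq, mt SimpleGraph.Adj.symm nyp,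
        mt SimpleGraph.Adj.symm nyq]

/-- A stable set of size four forces the graph to be edgeless. -/
theorem stable_univ_of_card_four [Fintype V] (hclaw : ¬ claw.IsIndContained G)
    (hco : ¬ coDiamond.IsIndContained G) {S : Finset V} (hS : Stable G.Adj S) (hc : S.card = 4) :
    Stable G.Adj Finset.univ := by
  classical
  obtain ⟨p, q, s, t, hpq, hps, hpt, hqs, hqt, hst, rfl⟩ := Finset.card_eq_four.1 hc
  have npq := hS p (by simp) q (by simp)
  have nps := hS p (by simp) s (by simp)
  have npt := hS p (by simp) t (by simp)
  have nqs := hS q (by simp) s (by simp)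
  have nqt := hS q (by simp) t (by simp)
  have nst := hS s (by simp) t (by simp)
  -- No vertex `w` sees a member `a` of the stable set. Of any two other members `w` sees one, else
  -- they form a co-diamond with the edge `w a`. So `w` sees two of the other three, and these give
  -- a claw with `a`.
  have out : ∀ w, ∀ a b c d : V, a ≠ b → a ≠ c → a ≠ d → b ≠ c → b ≠ d → c ≠ d → ¬ G.Adj a b →
      ¬ G.Adj a c → ¬ G.Adj a d → ¬ G.Adj b c → ¬ G.Adj b d → ¬ G.Adj c d → ¬ G.Adj w a := by
    intro w a b c d hab hac had hbc hbd hcd nab nac nad nbc nbd ncd hwa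
    have hw : ∀ x, ¬ G.Adj a x → w ≠ x := by
      rintro x h rfl
      exact h hwa.symm
    have two : ∀ x y, a ≠ x → a ≠ y → x ≠ y → ¬ G.Adj a x → ¬ G.Adj a y → ¬ G.Adj x y →
        G.Adj w x ∨ G.Adj w y := by
      intro x y hax hay hxy nax nay nxy
      by_contra! hcon
      exact not_coDiamond hco hwa hxy (hw x nax).symm hax.symm (hw y nay).symm hay.symm nxy
        (fun h => hcon.1 h.symm) (fun h => nax h.symm) (fun h => hcon.2 h.symm)
        (fun h => nay h.symm)
    have cl : ∀ x y, a ≠ x → a ≠ y → x ≠ y → ¬ G.Adj a x → ¬ G.Adj a y → ¬ G.Adj x y →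
        G.Adj w x → G.Adj w y → False := fun x y hax hay hxy nax nay nxy hwx hwy =>
      not_claw hclaw hwa hwx hwy hax hay hxy nax nay nxy
    rcases two b c hab hac hbc nab nac nbc with h1 | h1
    · rcases two c d hac had hcd nac nad ncd with h2 | h2
      · exact cl b c hab hac hbc nab nac nbc h1 h2
      · exact cl b d hab had hbd nab nad nbd h1 h2
    · rcases two b d hab had hbd nab nad nbd with h2 | h2
      · exact cl b c hab hac hbc nab nac nbc h2 h1
      · exact cl c d hac had hcd nac nad ncd h1 h2
  have sy : ∀ {x y : V}, ¬ G.Adj x y → ¬ G.Adj y x := fun h h' => h h'.symm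
  have np : ∀ w, ¬ G.Adj w p := fun w => out w p q s t hpq hps hpt hqs hqt hst npq nps npt nqs nqt
    nst
  have nq : ∀ w, ¬ G.Adj w q := fun w => out w q p s t hpq.symm hqs hqt hps hpt hst (sy npq) nqs
    nqt nps npt nst
  intro x _ y _ hxy
  have h1 : ∀ {a z : V}, (∀ w, ¬ G.Adj w a) → ∀ w, G.Adj z w → a ≠ z := by
    rintro a z h w hzw rfl
    exact h w hzw.symm
  -- Any edge, together with the isolated vertices `p` and `q`, would be a co-diamond.
  exact not_coDiamond hco hxy hpq (h1 np y hxy) (h1 np x hxy.symm) (h1 nq y hxy) (h1 nq x hxy.symm)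
    npq (sy (np x)) (sy (np y)) (sy (nq x)) (sy (nq y))

/-! ### Graphs without a stable triple -/

/-- The adjacency of the pentagon. -/
def pentagonAdj (v w : ℕ) : Bool := (v + 1) % 5 == w || (w + 1) % 5 == v

theorem isEPositive_of_pentagon [Fintype V] {a b c d e : V} (hab : G.Adj a b) (hbc : G.Adj b c)
    (hcd : G.Adj c d) (hde : G.Adj d e) (hea : G.Adj e a) (nac : ¬ G.Adj a c) (nad : ¬ G.Adj a d)
    (nbe : ¬ G.Adj b e) (nbd : ¬ G.Adj b d) (nce : ¬ G.Adj c e)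
    (hall : ∀ w, w = a ∨ w = b ∨ w = c ∨ w = d ∨ w = e)
    (hst : ∀ S : Finset V, Stable G.Adj S → S.card ≤ 3) : IsEPositive (chromaticSymmFun G) := by
  classical
  have hadj : ∀ i j : Fin 5, G.Adj (![a, b, c, d, e] i) (![a, b, c, d, e] j) ↔
      pentagonAdj i j = true := by
    intro i j
    fin_cases i <;> fin_cases j <;>
      simp [pentagonAdj, hab, hbc, hcd, hde, hea, hab.symm, hbc.symm, hcd.symm, hde.symm, hea.symm,
        nac, nad, nbe, nbd, nce, mt SimpleGraph.Adj.symm nac, mt SimpleGraph.Adj.symm nad,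
        mt SimpleGraph.Adj.symm nbe, mt SimpleGraph.Adj.symm nbd, mt SimpleGraph.Adj.symm nce]
  have hg : Function.Bijective ![a, b, c, d, e] := by
    refine ⟨fun i j hij => ?_, fun w => ?_⟩
    -- Vertices of a pentagon are determined by their neighborhoods, so distinctness of the five
    -- vertices follows from the adjacencies.
    · have h1 : ∀ i j : Fin 5, (∀ k : Fin 5, pentagonAdj i k = pentagonAdj j k) → i = j := by
        decide
      refine h1 i j fun k => Bool.eq_iff_iff.2 ?_
      rw [← hadj, ← hadj, hij]
    · rcases hall w with rfl | rfl | rfl | rfl | rfl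
      · exact ⟨0, rfl⟩
      · exact ⟨1, rfl⟩
      · exact ⟨2, rfl⟩
      · exact ⟨3, rfl⟩
      · exact ⟨4, rfl⟩
  generalize ![a, b, c, d, e] = g at hadj hg
  let e := Equiv.ofBijective g hg
  refine isEPositive_of_ePosCheck (adj := pentagonAdj) (l := List.range 5)
    (f := fun v => (e.symm v : ℕ)) ?_ ?_ List.nodup_range ?_ ?_ ?_ hst (by decide +kernel)
  · intro x y
    rw [pentagonAdj, pentagonAdj, Bool.or_comm]
  · intro x
    simp [pentagonAdj]
    omega
  · exact fun u v h => e.symm.injective (Fin.ext h)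
  · intro u v
    rw [← hadj]
    change _ ↔ G.Adj (e (e.symm u)) (e (e.symm v))
    simp
  · ext i
    simp only [Finset.mem_image, Finset.mem_univ, true_and, List.mem_toFinset, List.mem_range]
    constructor
    · rintro ⟨v, rfl⟩
      exact (e.symm v).2
    · intro hi
      exact ⟨e ⟨i, hi⟩, by simp⟩

/-- Assume that no two cliques cover `G`, and fix a vertex `v`. Its non-neighbors form a clique, so
its neighborhood contains a non-adjacent pair `x`, `y`, and splits into a clique around `x` and one
around `y` with no edges in between. Each of these cliques turns out to be a single vertex, and
exactly two non-neighbors of `v` remain; this is a pentagon. -/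
theorem isEPositive_of_no_stable_triple [Fintype V] (hdia : ¬ diamond.IsIndContained G)
    (h3 : ∀ x y z : V, x ≠ y → x ≠ z → y ≠ z → ¬ G.Adj x y → ¬ G.Adj x z → G.Adj y z)
    (hst : ∀ S : Finset V, Stable G.Adj S → S.card ≤ 3) :
    IsEPositive (chromaticSymmFun G) := by
  classical
  by_cases hcob : ∃ P : V → Prop, (∀ u v, P u → P v → u ≠ v → G.Adj u v) ∧
      ∀ u v, ¬ P u → ¬ P v → u ≠ v → G.Adj u v
  · obtain ⟨P, h1, h2⟩ := hcob
    exact isEPositive_of_two_cliques G (Finset.univ.filter P)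
      (fun u hu v hv => h1 u v (Finset.mem_filter.1 hu).2 (Finset.mem_filter.1 hv).2)
      (fun u hu v hv => h2 u v (by simpa using hu) (by simpa using hv))
  · have hP : ∀ P : V → Prop, (∀ u v, P u → P v → u ≠ v → G.Adj u v) →
        ∃ u v, ¬ P u ∧ ¬ P v ∧ u ≠ v ∧ ¬ G.Adj u v := by
      intro P h
      by_contra! hcon
      exact hcob ⟨P, h, hcon⟩
    obtain ⟨v, -⟩ := hP (fun _ => False) (fun _ _ h => h.elim)
    have hM : ∀ m m', m ≠ v → m' ≠ v → ¬ G.Adj v m → ¬ G.Adj v m' → m ≠ m' → G.Adj m m' :=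
      fun m m' hm hm' n n' hne => h3 v m m' hm.symm hm'.symm hne n n'
    obtain ⟨x, y, hx, hy, hxy, nxy⟩ : ∃ x y, G.Adj v x ∧ G.Adj v y ∧ x ≠ y ∧ ¬ G.Adj x y := by
      obtain ⟨x, y, hx, hy, h⟩ := hP (fun u => u ≠ v ∧ ¬ G.Adj v u)
        (fun u w hu hw => hM u w hu.1 hw.1 hu.2 hw.2)
      by_contra! hcon
      refine hcob ⟨fun u => u ≠ v ∧ ¬ G.Adj v u, fun u w hu hw => hM u w hu.1 hw.1 hu.2 hw.2,
        fun u w hu hw huw => ?_⟩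
      rw [not_and_not_right] at hu hw
      by_cases huv : u = v
      · subst huv
        exact hw huw.symm
      · by_cases hwv : w = v
        · subst hwv
          exact (hu huv).symm
        · exact hcon u w (hu huv) (hw hwv) huw
    have hnv : ∀ u, G.Adj v u → u ≠ v := fun u h => h.ne'
    -- A common neighbor of `v`, `x`, `y` would give a diamond; a neighbor of `v` adjacent to
    -- neither `x` nor `y` gives a stable triple.
    have dich : ∀ x y, G.Adj v x → G.Adj v y → x ≠ y → ¬ G.Adj x y → ∀ u, G.Adj v u → u ≠ x →
        u ≠ y → (G.Adj x u ↔ ¬ G.Adj y u) := by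
      intro x y hx hy hxy nxy u hu hux huy
      constructor
      · intro h1 h2
        exact nxy (not_diamond hdia hu hx hy h1.symm h2.symm hxy)
      · intro h2
        by_contra h1
        exact h2 (h3 x y u hxy hux.symm huy.symm nxy h1)
    have side : ∀ x, G.Adj v x → (∀ u w, G.Adj v u → G.Adj v w → (u = x ∨ G.Adj x u) →
        (w = x ∨ G.Adj x w) → u ≠ w → G.Adj u w) := by
      rintro x hx u w hu hw (rfl | hxu) (rfl | hxw) huw
      · exact absurd rfl huw
      · exact hxw
      · exact hxu.symm
      · exact not_diamond hdia hx hu hw hxu hxw huw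
    -- Since `v` with the clique around `x` is a clique, the remaining vertices are not. They are
    -- the non-neighbors of `v` and the clique around `y`, so a non-adjacent pair has one vertex in
    -- each.
    have ex : ∀ x y, G.Adj v x → G.Adj v y → x ≠ y → ¬ G.Adj x y → ∃ m y', ¬ G.Adj v m ∧ m ≠ v ∧ G.Adj v y' ∧
        (y' = y ∨ G.Adj y y') ∧ ¬ G.Adj m y' := by
      intro x y hx hy hxy nxy
      by_contra! hcon
      obtain ⟨a, b, ha, hb, hab, nab⟩ := hP (fun u => u = v ∨ (G.Adj v u ∧ (u = x ∨ G.Adj x u)))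
        (by
          rintro u w (rfl | ⟨hu, hu'⟩) (rfl | ⟨hw, hw'⟩) huw
          · exact absurd rfl huw
          · exact hw
          · exact hu.symm
          · exact side x hx u w hu hw hu' hw' huw)
      have hcls : ∀ a, ¬ (a = v ∨ (G.Adj v a ∧ (a = x ∨ G.Adj x a))) → a ≠ v ∧
          (G.Adj v a → a = y ∨ G.Adj y a) := by
        intro a ha
        rw [not_or] at ha
        refine ⟨ha.1, fun hva => ?_⟩
        by_contra! hcon2
        have h1 : a ≠ x ∧ ¬ G.Adj x a := by
          by_contra h
          refine ha.2 ⟨hva, ?_⟩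
          by_contra! h'
          exact h h'
        exact h1.2 ((dich x y hx hy hxy nxy a hva h1.1 hcon2.1).2 hcon2.2)
      obtain ⟨hav, ha'⟩ := hcls a ha
      obtain ⟨hbv, hb'⟩ := hcls b hb
      by_cases hva : G.Adj v a
      · by_cases hvb : G.Adj v b
        · exact nab (side y hy a b hva hvb (ha' hva) (hb' hvb) hab)
        · exact nab (hcon b a hvb hbv hva (ha' hva)).symm
      · by_cases hvb : G.Adj v b
        · exact nab (hcon a b hva hav hvb (hb' hvb))
        · exact nab (hM a b hav hbv hva hvb hab)
    obtain ⟨m, y', hm, hmv, hy', hyy', nmy⟩ := ex x y hx hy hxy nxy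
    obtain ⟨m', x', hm', hmv', hx', hxx', nmx⟩ := ex y x hy hx hxy.symm fun h => nxy h.symm
    have sep : ∀ x y, G.Adj v x → G.Adj v y → x ≠ y → ¬ G.Adj x y → ∀ u w, G.Adj v u →
        (u = x ∨ G.Adj x u) → G.Adj v w → (w = y ∨ G.Adj y w) → u ≠ w ∧ ¬ G.Adj u w := by
      intro x y hx hy hxy nxy u w hu hxu hw hyw
      have hwx : w ≠ x := by
        rintro rfl
        rcases hyw with rfl | h
        · exact hxy rfl
        · exact nxy h.symm
      have nxw : ¬ G.Adj x w := by
        intro h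
        rcases hyw with rfl | h'
        · exact nxy h
        · exact (dich x y hx hy hxy nxy w hw hwx h'.ne').1 h h'
      rcases hxu with rfl | hxu
      · exact ⟨hwx.symm, nxw⟩
      · refine ⟨fun h => nxw (h ▸ hxu), fun h => nxw ?_⟩
        exact (not_diamond hdia hu hw hx h hxu.symm hwx).symm
    -- As `m` and the clique around `x` both miss `y'`, the absence of stable triples joins `m` to
    -- all of that clique. A second vertex `u` in it would make `x u` the middle edge of a diamond
    -- with `v` and `m`.
    have single : ∀ x y, G.Adj v x → G.Adj v y → x ≠ y → ¬ G.Adj x y → ∀ m y', ¬ G.Adj v m →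
        m ≠ v → G.Adj v y' → (y' = y ∨ G.Adj y y') → ¬ G.Adj m y' → G.Adj m x ∧
        ∀ u, G.Adj v u → (u = x ∨ G.Adj x u) → u = x := by
      intro x y hx hy hxy nxy m y' hm hmv hy' hyy' nmy
      have hmu : ∀ u, G.Adj v u → (u = x ∨ G.Adj x u) → G.Adj m u := by
        intro u hu hxu
        obtain ⟨h1, h2⟩ := sep x y hx hy hxy nxy u y' hu hxu hy' hyy'
        refine h3 y' m u ?_ h1.symm ?_ (mt SimpleGraph.Adj.symm nmy) (mt SimpleGraph.Adj.symm h2)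
        · rintro rfl
          exact hm hy'
        · rintro rfl
          exact hm hu
      have hmx := hmu x hx (Or.inl rfl)
      refine ⟨hmx, fun u hu hxu => ?_⟩
      rcases hxu with hxu | hxu
      · exact hxu
      · exact absurd (not_diamond hdia hxu hx.symm hmx.symm hu.symm
          (hmu u hu (Or.inr hxu)).symm hmv.symm) hm
    obtain ⟨hmx, hX⟩ := single x y hx hy hxy nxy m y' hm hmv hy' hyy' nmy
    obtain ⟨hmy, hY⟩ := single y x hy hx hxy.symm (mt SimpleGraph.Adj.symm nxy) m' x' hm' hmv' hx'
      hxx' nmx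
    obtain rfl := hY y' hy' hyy'
    obtain rfl := hX x' hx' hxx'
    have hmm' : m ≠ m' := by
      rintro rfl
      exact nmx hmx
    have hmm := hM m m' hmv hmv' hm hm' hmm'
    -- A further vertex `w` must be a non-neighbor of `v`, hence adjacent to `m` and `m'`, and to
    -- `x'` or `y'`. Either choice gives a diamond, with middle edge `w m` or `w m'`.
    have hall : ∀ w, w = v ∨ w = x' ∨ w = m ∨ w = m' ∨ w = y' := by
      intro w
      by_contra! hw
      obtain ⟨hwv, hwx, hwm, hwm', hwy⟩ := hw
      by_cases hvw : G.Adj v w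
      · by_cases hyw : G.Adj y' w
        · exact hwy (hY w hvw (Or.inr hyw))
        · exact hwx (hX w hvw (Or.inr ((dich x' y' hx hy hxy nxy w hvw hwx hwy).2 hyw)))
      · have h1 := hM w m hwv hmv hvw hm hwm
        have h2 := hM w m' hwv hmv' hvw hm' hwm'
        by_cases hxw : G.Adj x' w
        · refine nmx (not_diamond hdia h1 hxw.symm h2 hmx hmm ?_).symm
          rintro rfl
          exact hm' hx
        · have hyw := h3 x' y' w hxy hwx.symm hwy.symm nxy hxw
          refine nmy (not_diamond hdia h2 hyw.symm h1 hmy hmm.symm ?_).symm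
          rintro rfl
          exact hm hy
    exact isEPositive_of_pentagon hx hmx.symm hmm hmy hy.symm hm hm' nxy (mt SimpleGraph.Adj.symm nmx)
      nmy hall hst

end

/-! ### Coded graphs with a stable triple -/

/-- A vertex `3 * s + c` stands for the vertex of class `c` in slot `s`. The vertices in slot `0`
are a stable triple, the others are adjacent to the two members of the triple outside their class,
and the adjacency between two classes is given by the slots and one bit. -/
def codeAdj (e : ℕ → Bool) (v w : ℕ) : Bool :=
  v % 3 != w % 3 && ((v / 3 == 0) != (w / 3 == 0) ||
    v / 3 != 0 && w / 3 != 0 && ((v / 3 == 1) != (w / 3 == 1)) != e (3 - v % 3 - w % 3))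

/-- The first `p` vertices of class `c`. -/
def slots (p c : ℕ) : List ℕ := (List.range p).map fun s => 3 * s + c

/-- Three bits as a function. -/
def threeBits (a b c : Bool) (i : ℕ) : Bool := if i = 0 then a else if i = 1 then b else c

/-- There is a triangle on the vertices outside the stable triple with all classes different. -/
def hasTransversalTriangle (e : ℕ → Bool) (p q r : ℕ) : Bool :=
  (slots p 0).any fun u => (slots q 1).any fun v => (slots r 2).any fun w =>
    u / 3 != 0 && v / 3 != 0 && w / 3 != 0 && codeAdj e u v && codeAdj e u w && codeAdj e v w

/-- The class sizes are p ≤ q ≤ r ≤ 2, and slot 0 adds one vertex to each. Codes with a transversal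
triangle are skipped, as they contain a diamond. -/
theorem codeCheck : ((List.range 3).all fun r => (List.range (r + 1)).all fun q =>
    (List.range (q + 1)).all fun p => [true, false].all fun a => [true, false].all fun b =>
    [true, false].all fun c =>
      hasTransversalTriangle (threeBits a b c) (p + 1) (q + 1) (r + 1) ||
      ePosCheck (codeAdj (threeBits a b c))
        (slots (p + 1) 0 ++ slots (q + 1) 1 ++ slots (r + 1) 2)) = true := by
  decide +kernel

theorem codeAdj_comm (e : ℕ → Bool) (v w : ℕ) : codeAdj e v w = codeAdj e w v := by
  have h : 3 - v % 3 - w % 3 = 3 - w % 3 - v % 3 := by omega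
  simp only [codeAdj, h, bne_comm (a := v % 3), bne_comm (a := v / 3 == 0),
    bne_comm (a := v / 3 == 1), Bool.and_comm (v / 3 != 0)]

theorem codeAdj_self (e : ℕ → Bool) (v : ℕ) : codeAdj e v v = false := by
  simp [codeAdj]

theorem codeAdj_mk (e : ℕ → Bool) {s s' c c' : ℕ} (hc : c < 3) (hc' : c' < 3) :
    codeAdj e (3 * s + c) (3 * s' + c') = (c != c' && ((s == 0) != (s' == 0) ||
      s != 0 && s' != 0 && ((s == 1) != (s' == 1)) != e (3 - c - c'))) := by
  rw [codeAdj, show (3 * s + c) % 3 = c by omega, show (3 * s + c) / 3 = s by omega,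
    show (3 * s' + c') % 3 = c' by omega, show (3 * s' + c') / 3 = s' by omega]

theorem mem_slots {p c v : ℕ} (hc : c < 3) : v ∈ slots p c ↔ v % 3 = c ∧ v / 3 < p := by
  simp only [slots, List.mem_map, List.mem_range]
  constructor
  · rintro ⟨s, hs, rfl⟩
    omega
  · rintro ⟨h1, h2⟩
    exact ⟨v / 3, h2, by omega⟩

theorem nodup_slots (p c : ℕ) : (slots p c).Nodup :=
  List.nodup_range.map fun a b h => by simpa using h

theorem nodup_slots_append (p q r : ℕ) : (slots p 0 ++ slots q 1 ++ slots r 2).Nodup := by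
  rw [List.nodup_append', List.nodup_append']
  refine ⟨⟨nodup_slots _ _, nodup_slots _ _, fun v h1 h2 => ?_⟩, nodup_slots _ _,
    fun v h1 h2 => ?_⟩
  · rw [mem_slots (by omega)] at h1 h2
    omega
  · rw [List.mem_append, mem_slots (by omega), mem_slots (by omega)] at h1
    rw [mem_slots (by omega)] at h2
    omega

theorem exists_enumeration {V : Type*} (W : Finset V) :
    ∃ σ : V → ℕ, Set.InjOn σ W ∧ ∀ i, (∃ w ∈ W, σ w = i) ↔ i < W.card := by
  classical
  refine ⟨fun v => if h : v ∈ W then (W.equivFin ⟨v, h⟩ : ℕ) else 0, fun u hu v hv h => ?_,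
    fun i => ⟨?_, fun hi => ?_⟩⟩
  · rw [Finset.mem_coe] at hu hv
    simp only [hu, hv, dif_pos] at h
    simpa using W.equivFin.injective (Fin.ext h)
  · rintro ⟨w, hw, rfl⟩
    simp only [hw, dif_pos]
    exact (W.equivFin ⟨w, hw⟩).2
  · refine ⟨W.equivFin.symm ⟨i, hi⟩, (W.equivFin.symm ⟨i, hi⟩).2, ?_⟩
    simp

/-- With at most two elements on each side, the relation flips whenever `x` or `y` is exchanged for
the other element. It is therefore the exclusive or of the two positions and a constant, read off at
one pair; if there is no pair, any constant serves. -/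
theorem exists_bit {V : Type*} {r : V → V → Prop} {X Y : Finset V} {σ τ : V → ℕ}
    (hσ : Set.InjOn σ X) (hτ : Set.InjOn τ Y) (hσ2 : ∀ x ∈ X, σ x < 2) (hτ2 : ∀ y ∈ Y, τ y < 2)
    (hX : ∀ x ∈ X, ∀ x' ∈ X, x ≠ x' → ∀ y ∈ Y, (r x y ↔ ¬ r x' y))
    (hY : ∀ y ∈ Y, ∀ y' ∈ Y, y ≠ y' → ∀ x ∈ X, (r x y ↔ ¬ r x y')) :
    ∃ b : Bool, ∀ x ∈ X, ∀ y ∈ Y,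
      (r x y ↔ (((σ x + 1 == 1) != (τ y + 1 == 1)) != b) = true) := by
  classical
  by_cases hne : ∃ x y, x ∈ X ∧ y ∈ Y
  · obtain ⟨x₀, y₀, hx₀, hy₀⟩ := hne
    refine ⟨((σ x₀ + 1 == 1) != (τ y₀ + 1 == 1)) != decide (r x₀ y₀), fun x hx y hy => ?_⟩
    have h1 : decide (r x y) =
        (decide (r x₀ y) != ((σ x + 1 == 1) != (σ x₀ + 1 == 1))) := by
      by_cases h : x = x₀
      · subst h
        simp
      · have h2 : (σ x + 1 == 1) = !(σ x₀ + 1 == 1) := by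
          have h3 : σ x ≠ σ x₀ := fun h' => h (hσ hx hx₀ h')
          have h4 := hσ2 x hx
          have h5 := hσ2 x₀ hx₀
          rw [Bool.eq_iff_iff]
          simp
          omega
        have h3 : decide (r x y) = !decide (r x₀ y) := by
          rw [Bool.eq_iff_iff]
          simpa using hX x hx x₀ hx₀ h y hy
        rw [h2, h3]
        cases (σ x₀ + 1 == 1) <;> simp
    have h2 : decide (r x₀ y) =
        (decide (r x₀ y₀) != ((τ y + 1 == 1) != (τ y₀ + 1 == 1))) := by
      by_cases h : y = y₀
      · subst h
        simp
      · have h2 : (τ y + 1 == 1) = !(τ y₀ + 1 == 1) := by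
          have h3 : τ y ≠ τ y₀ := fun h' => h (hτ hy hy₀ h')
          have h4 := hτ2 y hy
          have h5 := hτ2 y₀ hy₀
          rw [Bool.eq_iff_iff]
          simp
          omega
        have h3 : decide (r x₀ y) = !decide (r x₀ y₀) := by
          rw [Bool.eq_iff_iff]
          simpa using hY y hy y₀ hy₀ h x₀ hx₀
        rw [h2, h3]
        cases (τ y₀ + 1 == 1) <;> simp
    rw [← decide_eq_true_iff (p := r x y), h1, h2]
    generalize (σ x + 1 == 1) = a
    generalize (σ x₀ + 1 == 1) = b
    generalize (τ y + 1 == 1) = c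
    generalize (τ y₀ + 1 == 1) = d
    generalize decide (r x₀ y₀) = f
    cases a <;> cases b <;> cases c <;> cases d <;> cases f <;> simp
  · refine ⟨true, fun x hx y hy => absurd ⟨x, y, hx, hy⟩ hne⟩

/-! ### The structure around a stable triple -/

section
variable {V : Type*} [Fintype V] {G : SimpleGraph V}

open Classical in
/-- The vertices whose only non-neighbor among the `t r'` is `t r`. -/
noncomputable def classOf (G : SimpleGraph V) (t : Fin 3 → V) (r : Fin 3) : Finset V :=
  Finset.univ.filter fun w => ∀ r', G.Adj w (t r') ↔ r' ≠ r

theorem mem_classOf {t : Fin 3 → V} {r : Fin 3} {w : V} :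
    w ∈ classOf G t r ↔ ∀ r', G.Adj w (t r') ↔ r' ≠ r := by
  simp [classOf]

theorem eq_of_mem_classOf {t : Fin 3 → V} {r r' : Fin 3} {w : V} (h : w ∈ classOf G t r)
    (h' : w ∈ classOf G t r') : r = r' := by
  by_contra hne
  exact (mem_classOf.1 h r).1 ((mem_classOf.1 h' r).2 hne) rfl

theorem notMem_classOf {t : Fin 3 → V} (ht : ∀ i j, ¬ G.Adj (t i) (t j)) (i r : Fin 3) :
    t i ∉ classOf G t r := by
  intro h
  obtain ⟨j, hj⟩ := exists_ne r
  exact ht i j ((mem_classOf.1 h j).2 hj)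

theorem exists_mem_classOf (hclaw : ¬ claw.IsIndContained G) (hco : ¬ coDiamond.IsIndContained G)
    (hst : ∀ S : Finset V, Stable G.Adj S → S.card ≤ 3) {t : Fin 3 → V}
    (hinj : Function.Injective t) (ht : ∀ i j, ¬ G.Adj (t i) (t j)) {w : V}
    (hw : ∀ r, w ≠ t r) : ∃ r, w ∈ classOf G t r := by
  classical
  have hne : ∀ {i j}, i ≠ j → t i ≠ t j := fun h h' => h (hinj h')
  have one : ∀ i j k : Fin 3, i ≠ j → i ≠ k → j ≠ k → G.Adj w (t i) → ¬ G.Adj w (t j) →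
      ¬ G.Adj w (t k) → False := fun i j k hij hik hjk h1 h2 h3 =>
    not_coDiamond hco h1 (hne hjk) (hw j).symm (hne hij.symm) (hw k).symm (hne hik.symm) (ht j k)
      (mt SimpleGraph.Adj.symm h2) (ht j i) (mt SimpleGraph.Adj.symm h3) (ht k i)
  simp only [mem_classOf]
  by_cases h0 : G.Adj w (t 0) <;> by_cases h1 : G.Adj w (t 1) <;> by_cases h2 : G.Adj w (t 2)
  · exact (not_claw hclaw h0 h1 h2 (hne (by decide)) (hne (by decide)) (hne (by decide)) (ht _ _)
      (ht _ _) (ht _ _)).elim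
  · exact ⟨2, by simp [Fin.forall_fin_succ, h0, h1, h2]⟩
  · exact ⟨1, by simp [Fin.forall_fin_succ, h0, h1, h2]⟩
  · exact (one 0 1 2 (by decide) (by decide) (by decide) h0 h1 h2).elim
  · exact ⟨0, by simp [Fin.forall_fin_succ, h0, h1, h2]⟩
  · exact (one 1 0 2 (by decide) (by decide) (by decide) h1 h0 h2).elim
  · exact (one 2 0 1 (by decide) (by decide) (by decide) h2 h0 h1).elim
  · have h3 := hst (insert w (Finset.univ.image t)) (by
      have h4 : ∀ i, ¬ G.Adj w (t i) := by simp [Fin.forall_fin_succ, h0, h1, h2]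
      intro x hx y hy
      simp only [Finset.mem_insert, Finset.mem_image, Finset.mem_univ, true_and] at hx hy
      rcases hx with rfl | ⟨i, rfl⟩ <;> rcases hy with rfl | ⟨j, rfl⟩
      · exact G.irrefl
      · exact h4 j
      · exact mt SimpleGraph.Adj.symm (h4 i)
      · exact ht i j)
    rw [Finset.card_insert_of_notMem (by
      simp only [Finset.mem_image, Finset.mem_univ, true_and, not_exists]
      exact fun r h => hw r h.symm), Finset.card_image_of_injective _ hinj] at h3
    simp at h3

/-- Adjacent `u` and `w` would have two non-adjacent common neighbors in the triple, hence span a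
diamond with them. -/
theorem not_adj_of_mem_classOf (hdia : ¬ diamond.IsIndContained G) {t : Fin 3 → V}
    (hinj : Function.Injective t) (ht : ∀ i j, ¬ G.Adj (t i) (t j)) {r : Fin 3} {u w : V}
    (hu : u ∈ classOf G t r) (hw : w ∈ classOf G t r) : ¬ G.Adj u w := by
  intro h
  rw [mem_classOf] at hu hw
  obtain ⟨i, j, hi, hj, hij⟩ :=
    (by decide : ∀ r : Fin 3, ∃ i j, i ≠ r ∧ j ≠ r ∧ i ≠ j) r
  exact ht i j (not_diamond hdia h ((hu i).2 hi) ((hu j).2 hj) ((hw i).2 hi) ((hw j).2 hj)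
    fun h' => hij (hinj h'))

theorem card_classOf_le (hclaw : ¬ claw.IsIndContained G) (hdia : ¬ diamond.IsIndContained G)
    {t : Fin 3 → V} (hinj : Function.Injective t) (ht : ∀ i j, ¬ G.Adj (t i) (t j)) (r : Fin 3) :
    (classOf G t r).card ≤ 2 := by
  by_contra! hcon
  obtain ⟨a, ha, b, hb, c, hc, hab, hac, hbc⟩ := Finset.two_lt_card.1 hcon
  have hn := fun {u w} => not_adj_of_mem_classOf hdia hinj ht (r := r) (u := u) (w := w)
  obtain ⟨i, hi⟩ := exists_ne r
  have hadj : ∀ {u}, u ∈ classOf G t r → G.Adj (t i) u := fun hu =>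
    ((mem_classOf.1 hu i).2 hi).symm
  exact not_claw hclaw (hadj ha) (hadj hb) (hadj hc) hab hac hbc (hn ha hb) (hn ha hc) (hn hb hc)

/-- Some `t i` sees all of `u`, `w`, `z`, and `u`, `w` are not adjacent. If `z` sees both, the edge
from `t i` to `z` is the middle of a diamond; if it sees neither, `t i` is the center of a claw. -/
theorem adj_iff_not_adj_of_mem_classOf (hclaw : ¬ claw.IsIndContained G)
    (hdia : ¬ diamond.IsIndContained G)
    {t : Fin 3 → V} (hinj : Function.Injective t) (ht : ∀ i j, ¬ G.Adj (t i) (t j)) {r r' : Fin 3}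
    (hr : r ≠ r') {u w z : V} (hu : u ∈ classOf G t r) (hw : w ∈ classOf G t r) (huw : u ≠ w)
    (hz : z ∈ classOf G t r') : G.Adj u z ↔ ¬ G.Adj w z := by
  have hn := not_adj_of_mem_classOf hdia hinj ht hu hw
  obtain ⟨i, hi, hi'⟩ := (by decide : ∀ r r' : Fin 3, ∃ i, i ≠ r ∧ i ≠ r') r r'
  have hiu := ((mem_classOf.1 hu i).2 hi).symm
  have hiw := ((mem_classOf.1 hw i).2 hi).symm
  have hiz := ((mem_classOf.1 hz i).2 hi').symm
  have hne : ∀ {u}, u ∈ classOf G t r → u ≠ z := by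
    rintro u hu rfl
    exact hr (eq_of_mem_classOf hu hz)
  constructor
  · intro h1 h2
    exact hn (not_diamond hdia hiz hiu hiw h1.symm h2.symm huw)
  · intro h2
    by_contra h1
    exact not_claw hclaw hiu hiw hiz huw (hne hu) (hne hw) hn h1 h2

theorem isEPositive_of_stable_triple (hclaw : ¬ claw.IsIndContained G)
    (hdia : ¬ diamond.IsIndContained G) (hco : ¬ coDiamond.IsIndContained G)
    (hst : ∀ S : Finset V, Stable G.Adj S → S.card ≤ 3) {t : Fin 3 → V}
    (hinj : Function.Injective t) (ht : ∀ i j, ¬ G.Adj (t i) (t j)) :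
    IsEPositive (chromaticSymmFun G) := by
  classical
  -- Reordering the triple sorts the class sizes, as in the list covered by `codeCheck`.
  wlog hmono : Monotone fun r => (classOf G t r).card generalizing t
  · let σ := Tuple.sort fun r => (classOf G t r).card
    refine this (t := t ∘ σ) (hinj.comp σ.injective) (fun i j => ht _ _) ?_
    have h1 : ∀ r, classOf G (t ∘ σ) r = classOf G t (σ r) := by
      intro r
      ext w
      rw [mem_classOf, mem_classOf]
      constructor
      · intro h r'
        have := h (σ.symm r')
        rw [Function.comp_apply, Equiv.apply_symm_apply, ne_eq, Equiv.symm_apply_eq] at this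
        exact this
      · intro h r'
        rw [Function.comp_apply, h, ne_eq, σ.injective.eq_iff]
    simp only [h1]
    exact Tuple.monotone_sort fun r => (classOf G t r).card
  choose σ hσinj hσ using fun r => exists_enumeration (classOf G t r)
  have hcard := card_classOf_le hclaw hdia hinj ht
  have hσ2 : ∀ r, ∀ w ∈ classOf G t r, σ r w < 2 := fun r w hw =>
    ((hσ r _).1 ⟨w, hw, rfl⟩).trans_le (hcard r)
  have hbit : ∀ r r' : Fin 3, r ≠ r' → ∃ b : Bool, ∀ x ∈ classOf G t r, ∀ y ∈ classOf G t r',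
      (G.Adj x y ↔ (((σ r x + 1 == 1) != (σ r' y + 1 == 1)) != b) = true) := by
    intro r r' hr
    refine exists_bit (hσinj r) (hσinj r') (hσ2 r) (hσ2 r') ?_ ?_
    · exact fun x hx x' hx' hne y hy =>
        adj_iff_not_adj_of_mem_classOf hclaw hdia hinj ht hr hx hx' hne hy
    · intro y hy y' hy' hne x hx
      rw [G.adj_comm x y, G.adj_comm x y']
      exact adj_iff_not_adj_of_mem_classOf hclaw hdia hinj ht hr.symm hy hy' hne hx
  -- A bit is numbered by the class it does not involve, in accordance with the index 3 - c - c' in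
  -- `codeAdj`.
  obtain ⟨e2, he2⟩ := hbit 0 1 (by decide)
  obtain ⟨e1, he1⟩ := hbit 0 2 (by decide)
  obtain ⟨e0, he0⟩ := hbit 1 2 (by decide)
  -- Slot 0 is reserved for the triple, so the enumeration of a class is shifted by one.
  have hex : ∀ v, ∃ (c : Fin 3) (s : ℕ), (s = 0 ∧ v = t c) ∨
      (v ∈ classOf G t c ∧ s = σ c v + 1) := by
    intro v
    by_cases hv : ∃ c, v = t c
    · obtain ⟨c, hc⟩ := hv
      exact ⟨c, 0, Or.inl ⟨rfl, hc⟩⟩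
    · push Not at hv
      obtain ⟨c, hc⟩ := exists_mem_classOf hclaw hco hst hinj ht hv
      exact ⟨c, _, Or.inr ⟨hc, rfl⟩⟩
  choose c s hcs using hex
  have hadj : ∀ u v, G.Adj u v ↔
      codeAdj (threeBits e0 e1 e2) (3 * s u + c u) (3 * s v + c v) = true := by
    intro u v
    rw [codeAdj_mk _ (c u).2 (c v).2]
    have hcc : ((c u : ℕ) != (c v : ℕ)) = decide (c u ≠ c v) := by
      rw [Bool.eq_iff_iff]
      simp [Fin.ext_iff]
    rw [hcc]
    rcases hcs u with ⟨hsu, hu⟩ | ⟨hu, hsu⟩ <;> rcases hcs v with ⟨hsv, hv⟩ | ⟨hv, hsv⟩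
    · rw [hsu, hsv, hu, hv]
      simp [ht]
    · rw [G.adj_comm, hsu, hsv]
      conv_lhs => rw [hu]
      rw [mem_classOf.1 hv]
      simp
    · rw [hsu, hsv]
      conv_lhs => rw [hv]
      rw [mem_classOf.1 hu]
      rw [ne_comm]
      simp
    · by_cases hne : c u = c v
      · rw [hne] at hu
        simp [hne, not_adj_of_mem_classOf hdia hinj ht hu hv]
      · have key : G.Adj u v ↔ (((s u == 1) != (s v == 1)) !=
            threeBits e0 e1 e2 (3 - c u - c v)) = true := by
          rw [hsu, hsv]
          have hcomm : ∀ a b d : Bool, ((a != b) != d) = ((b != a) != d) := by decide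
          generalize c u = i at *
          generalize c v = j at *
          fin_cases i <;> fin_cases j
          · exact absurd rfl hne
          · exact he2 u hu v hv
          · exact he1 u hu v hv
          · rw [G.adj_comm, hcomm]
            exact he2 v hv u hu
          · exact absurd rfl hne
          · exact he0 u hu v hv
          · rw [G.adj_comm, hcomm]
            exact he1 v hv u hu
          · rw [G.adj_comm, hcomm]
            exact he0 v hv u hu
          · exact absurd rfl hne
        rw [key]
        have h1 : (s u != 0) = true := by rw [hsu]; simp
        have h2 : (s v != 0) = true := by rw [hsv]; simp
        have h3 : ((s u == 0) != (s v == 0)) = false := by rw [hsu, hsv]; simp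
        rw [h1, h2, h3]
        simp [hne]
  have hinjf : Function.Injective fun v => 3 * s v + (c v : ℕ) := by
    intro u v h
    simp only at h
    have h1 := (c u).2
    have h2 := (c v).2
    have hc : c u = c v := Fin.ext (by omega)
    have hs : s u = s v := by omega
    rcases hcs u with ⟨hsu, hu⟩ | ⟨hu, hsu⟩ <;> rcases hcs v with ⟨hsv, hv⟩ | ⟨hv, hsv⟩
    · rw [hu, hv, hc]
    · omega
    · omega
    · rw [hc] at hu hsu
      exact hσinj _ hu hv (by omega)
  have himg : ∀ x, (∃ v, 3 * s v + (c v : ℕ) = x) ↔ ∃ r : Fin 3, x % 3 = r ∧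
      x / 3 < (classOf G t r).card + 1 := by
    intro x
    constructor
    · rintro ⟨v, rfl⟩
      have h1 := (c v).2
      refine ⟨c v, by omega, ?_⟩
      rw [show (3 * s v + c v) / 3 = s v by omega]
      rcases hcs v with ⟨hsv, hv⟩ | ⟨hv, hsv⟩
      · omega
      · have := (hσ _ _).1 ⟨v, hv, rfl⟩
        omega
    · rintro ⟨r, h1, h2⟩
      by_cases h0 : x / 3 = 0
      · refine ⟨t r, ?_⟩
        rcases hcs (t r) with ⟨hsv, hv⟩ | ⟨hv, hsv⟩
        · rw [hsv, ← hinj hv]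
          omega
        · exact absurd hv (notMem_classOf ht _ _)
      · obtain ⟨w, hw, hwx⟩ := (hσ r (x / 3 - 1)).2 (by omega)
        refine ⟨w, ?_⟩
        rcases hcs w with ⟨hsv, hv⟩ | ⟨hv, hsv⟩
        · rw [hv] at hw
          exact absurd hw (notMem_classOf ht _ _)
        · rw [eq_of_mem_classOf hv hw] at hsv ⊢
          omega
  have h012 := hmono (show (0 : Fin 3) ≤ 1 by decide)
  have h122 := hmono (show (1 : Fin 3) ≤ 2 by decide)
  simp only at h012 h122
  have hcheck := codeCheck
  simp only [List.all_eq_true, List.mem_range] at hcheck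
  have hb : ∀ b : Bool, b ∈ [true, false] := by decide
  have hchk := hcheck _ (Nat.lt_succ_of_le (hcard 2)) _ (Nat.lt_succ_of_le h122) _
    (Nat.lt_succ_of_le h012) e0 (hb _) e1 (hb _) e2 (hb _)
  rw [Bool.or_eq_true] at hchk
  rcases hchk with htri | hpos
  · exfalso
    simp only [hasTransversalTriangle, List.any_eq_true, Bool.and_eq_true, bne_iff_ne, ne_eq] at htri
    obtain ⟨x, hx, y, hy, z, hz, ⟨⟨⟨⟨hx0, hy0⟩, hz0⟩, hxy⟩, hxz⟩, hyz⟩ := htri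
    rw [mem_slots (by omega)] at hx hy hz
    have lift : ∀ (r : Fin 3) (x : ℕ), x % 3 = r → x / 3 < (classOf G t r).card + 1 → x / 3 ≠ 0 →
        ∃ u, 3 * s u + (c u : ℕ) = x ∧ u ∈ classOf G t r := by
      intro r x h1 h2 h0
      obtain ⟨u, hu⟩ := (himg x).2 ⟨r, h1, h2⟩
      have h3 := (c u).2
      have h4 : c u = r := Fin.ext (by omega)
      refine ⟨u, hu, ?_⟩
      rw [← h4]
      rcases hcs u with ⟨h5, -⟩ | ⟨h5, -⟩
      · omega
      · exact h5
    obtain ⟨u, rfl, hu⟩ := lift 0 x hx.1 hx.2 hx0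
    obtain ⟨v, rfl, hv⟩ := lift 1 y hy.1 hy.2 hy0
    obtain ⟨w, rfl, hw⟩ := lift 2 z hz.1 hz.2 hz0
    rw [← hadj] at hxy hxz hyz
    -- For a transversal triangle, `t 2` sees `u` and `v` but not `w`, so `u v` is the middle edge
    -- of a diamond.
    have h1 : G.Adj u (t 2) := (mem_classOf.1 hu 2).2 (by decide)
    have h2 : G.Adj v (t 2) := (mem_classOf.1 hv 2).2 (by decide)
    have h3 : ¬ G.Adj w (t 2) := fun h => (mem_classOf.1 hw 2).1 h rfl
    refine h3 (not_diamond hdia hxy hxz h1 hyz h2 ?_)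
    rintro rfl
    exact ht 2 0 ((mem_classOf.1 hw 0).2 (by decide))
  · refine isEPositive_of_ePosCheck (codeAdj_comm _) (codeAdj_self _) (nodup_slots_append _ _ _)
      hinjf hadj ?_ hst hpos
    ext x
    rw [List.mem_toFinset, List.mem_append, List.mem_append, mem_slots (by omega),
      mem_slots (by omega), mem_slots (by omega)]
    simp only [Finset.mem_image, Finset.mem_univ, true_and, himg]
    rw [Fin.exists_fin_succ, Fin.exists_fin_two]
    exact or_assoc.symm

end

end ChromSymm

theorem mainTheorem4 {V : Type*} [Fintype V] (G : SimpleGraph V)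
    (hclaw : ¬ ChromSymm.claw.IsIndContained G)
    (hdiamond : ¬ ChromSymm.diamond.IsIndContained G)
    (hcodiamond : ¬ ChromSymm.coDiamond.IsIndContained G) :
    ChromSymm.IsEPositive (ChromSymm.chromaticSymmFun G) := by
  classical
  by_cases h4 : ∃ S : Finset V, ChromSymm.Stable G.Adj S ∧ 3 < S.card
  · obtain ⟨S, hS, hc⟩ := h4
    obtain ⟨T, hTS, hT⟩ := Finset.exists_subset_card_eq (show 4 ≤ S.card from hc)
    exact ChromSymm.isEPositive_of_stable G (ChromSymm.stable_univ_of_card_four hclaw hcodiamond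
      (fun x hx y hy => hS x (hTS hx) y (hTS hy)) hT)
  · push Not at h4
    by_cases h3 : ∃ x y z : V, x ≠ y ∧ x ≠ z ∧ y ≠ z ∧ ¬ G.Adj x y ∧ ¬ G.Adj x z ∧ ¬ G.Adj y z
    · obtain ⟨x, y, z, hxy, hxz, hyz, nxy, nxz, nyz⟩ := h3
      refine ChromSymm.isEPositive_of_stable_triple (t := ![x, y, z]) hclaw hdiamond hcodiamond h4
        ?_ ?_
      · intro i j hij
        fin_cases i <;> fin_cases j <;> simp_all
      · intro i j
        fin_cases i <;> fin_cases j <;> simp [nxy, nxz, nyz, mt SimpleGraph.Adj.symm nxy,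
          mt SimpleGraph.Adj.symm nxz, mt SimpleGraph.Adj.symm nyz]
    · push Not at h3
      exact ChromSymm.isEPositive_of_no_stable_triple hdiamond h3 h4
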